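/- A greedy knapsack budgeted game is given by nonnegative integers $l_1,w_1,\dots,l_n,w_n$ and $l_{\mathrm{bin}}$ with $0<l_k\le l_{\mathrm{bin}}$ for all $k$; the set of agents is $N=\{1,\dots,n\}$, and agent $k$ has length $l_k$ and weight $w_k$. Its characteristic function is $v(S)=\sum_{k\in\mathcal A'(S)}w_k$ for $S\subseteq N$, where $\mathcal A'(S)$ is the set returned by the following greedy heuristic ($\mathcal A'(\emptyset)=\emptyset$): let $a\in S$ be an agent of maximum weight in $S$; select the agents of $S$ one after the other in decreasing order of $w_k/l_k$ (ties broken by index), stopping as soon as the next agent does not fit into the remaining capacity of a bin of size $l_{\mathrm{bin}}$, and let $S'$ be the set of selected agents; return $S'$ if $\sum_{k\in S'}w_k\ge w_a$, and $\{a\}$ otherwise. Let $w_{\max}=\lceil l_{\mathrm{bin}}\cdot\max_k w_k/l_k\rceil$. The Shapley value of agent $i$ is $$\phi_i=\sum_{S\subseteq N\setminus\{i\}}\frac{|S|!\,(n-|S|-1)!}{n!}\bigl(v(S\cup\{i\})-v(S)\bigr).$$ Theorem. The Shapley value of each agent in a greedy knapsack budgeted game can be computed in time $O(l_{\mathrm{bin}}^5\,w_{\max}^5\,|N|^8)$.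 That is, there are a single program and a constant $C$ such that for every greedy knapsack budgeted game with at least one agent and every agent $i$, the program, started on $(n,l_{\mathrm{bin}},i,(l_k)_k,(w_k)_k)$, halts after at most $C\,l_{\mathrm{bin}}^5\,\max(1,w_{\max})^5\,n^8$ steps and outputs $\phi_i$ as a fraction of an integer and a positive integer. Here a program is one for a random access machine with integer registers and integer arrays (indirectly addressed), whose only arithmetic operations are addition and subtraction, with tests for positivity, and each constant, memory access, arithmetic operation, assignment and test counts as one step. -/

import Mathlib

namespace GreedyKnapsack

/-! ### Cooperative games and the Shapley value -/

/-- The Shapley value of agent `i` in the cooperative game with characteristic function `v`. -/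
noncomputable def shapley {N : Type*} [Fintype N] [DecidableEq N]
    (v : Finset N → ℝ) (i : N) : ℝ :=
  ∑ S ∈ (Finset.univ.erase i).powerset,
    ((S.card.factorial : ℝ) * ((Fintype.card N - S.card - 1).factorial : ℝ)
        / ((Fintype.card N).factorial : ℝ)) * (v (insert i S) - v S)

/-! ### Greedy knapsack budgeted games -/

/-- The representation of a (greedy) knapsack budgeted game with `n` agents: a length and a weight
for each agent and a bin size, all nonnegative integers, with `0 < l_k ≤ l_bin` for all `k`. -/
structure Rep (n : ℕ) where
  len : Fin n → ℕ
  weight : Fin n → ℕ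
  bin : ℕ
  len_pos : ∀ k, 0 < len k
  len_le_bin : ∀ k, len k ≤ bin

namespace Rep

variable {n : ℕ} (I : Rep n)

/-- The ratio of weight to length. -/
def ratio (k : Fin n) : ℚ := (I.weight k : ℚ) / (I.len k : ℚ)

/-- The order in which agents are considered: decreasing ratio, ties by index. -/
def precedes (j k : Fin n) : Prop :=
  I.ratio k < I.ratio j ∨ (I.ratio k = I.ratio j ∧ j ≤ k)

instance : DecidableRel I.precedes := fun j k =>
  inferInstanceAs (Decidable (I.ratio k < I.ratio j ∨ (I.ratio k = I.ratio j ∧ j ≤ k)))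

instance : IsTrans (Fin n) I.precedes where
  trans a b c hab hbc := by
    unfold precedes at *
    grind

instance : Std.Antisymm I.precedes where
  antisymm a b hab hba := by
    unfold precedes at *
    grind

instance : Std.Total I.precedes where
  total a b := by
    unfold precedes
    grind

/-- The agents of `S` in the order in which they are considered. -/
def sorted (S : Finset (Fin n)) : List (Fin n) := S.sort I.precedes

/-- Select agents from the list one after the other, and stop at the first one that does not fit
into the remaining capacity `b`. -/
def fill : List (Fin n) → ℕ → List (Fin n)
  | [], _ => []
  | k :: ks, b => if I.len k ≤ b then k :: fill ks (b - I.len k) else []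

/-- The set returned by the greedy heuristic: the agents selected by decreasing ratio, or the
heaviest agent `a` alone (the first one in the order if there are several) if it weighs more. -/
def greedy (S : Finset (Fin n)) : Finset (Fin n) :=
  match (I.sorted S).argmax I.weight with
  | none => ∅
  | some a =>
    let S' := (I.fill (I.sorted S) I.bin).toFinset
    if I.weight a ≤ ∑ k ∈ S', I.weight k then S' else {a}

/-- The characteristic function of the greedy knapsack budgeted game. -/
noncomputable def value (S : Finset (Fin n)) : ℝ := ∑ k ∈ I.greedy S, (I.weight k : ℝ)

/-- `w_max = ⌈l_bin · max_k (w_k / l_k)⌉`. -/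
def wmax : ℕ :=
  ⌈(I.bin : ℚ≥0) * Finset.univ.sup (fun k => (I.weight k : ℚ≥0) / (I.len k : ℚ≥0))⌉₊

end Rep

/-! ### Random access machine

Structured programs over integer registers and integer arrays. The only arithmetic operations are
addition and subtraction. A program is a finite object, so it refers to finitely many registers
and arrays; array cells are addressed indirectly, by computed integers. -/

/-- Integer expressions. -/
inductive Expr where
  | lit (z : ℤ)
  | reg (r : ℕ)
  | get (a : ℕ) (e : Expr)
  | add (e f : Expr)
  | sub (e f : Expr)

/-- Programs. The tests of `ite` and `loop` ask whether the expression is positive. -/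
inductive Prog where
  | skip
  | setReg (r : ℕ) (e : Expr)
  | setArr (a : ℕ) (e f : Expr)
  | seq (p q : Prog)
  | ite (e : Expr) (p q : Prog)
  | loop (e : Expr) (p : Prog)

/-- A memory state: the contents of the registers and of the array cells. -/
structure State where
  reg : ℕ → ℤ
  arr : ℕ → ℤ → ℤ

/-- The value of an expression. -/
def Expr.eval (σ : State) : Expr → ℤ
  | lit z => z
  | reg r => σ.reg r
  | get a e => σ.arr a (e.eval σ)
  | add e f => e.eval σ + f.eval σ
  | sub e f => e.eval σ - f.eval σ

/-- The number of steps needed to evaluate an expression: one for each constant, register access,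
array access, addition and subtraction. -/
def Expr.cost : Expr → ℕ
  | lit _ => 1
  | reg _ => 1
  | get _ e => e.cost + 1
  | add e f => e.cost + f.cost + 1
  | sub e f => e.cost + f.cost + 1

/-- `r := z` -/
def State.setReg (σ : State) (r : ℕ) (z : ℤ) : State where
  reg := Function.update σ.reg r z
  arr := σ.arr

/-- `a[x] := z` -/
def State.setArr (σ : State) (a : ℕ) (x z : ℤ) : State where
  reg := σ.reg
  arr := Function.update σ.arr a (Function.update (σ.arr a) x z)

/-- `Run p σ t τ`: started in state `σ`, program `p` halts in state `τ` after exactly `t` steps.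
Each execution of an assignment and each test costs one step plus the evaluation of its
expressions. -/
inductive Run : Prog → State → ℕ → State → Prop where
  | skip (σ : State) : Run .skip σ 1 σ
  | setReg (σ : State) (r : ℕ) (e : Expr) :
      Run (.setReg r e) σ (e.cost + 1) (σ.setReg r (e.eval σ))
  | setArr (σ : State) (a : ℕ) (e f : Expr) :
      Run (.setArr a e f) σ (e.cost + f.cost + 1) (σ.setArr a (e.eval σ) (f.eval σ))
  | seq {p q : Prog} {σ τ υ : State} {s t : ℕ} :
      Run p σ s τ → Run q τ t υ → Run (.seq p q) σ (s + t) υ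
  | ite_pos {e : Expr} {p q : Prog} {σ τ : State} {t : ℕ} :
      0 < e.eval σ → Run p σ t τ → Run (.ite e p q) σ (e.cost + 1 + t) τ
  | ite_neg {e : Expr} {p q : Prog} {σ τ : State} {t : ℕ} :
      ¬ 0 < e.eval σ → Run q σ t τ → Run (.ite e p q) σ (e.cost + 1 + t) τ
  | loop_done {e : Expr} {p : Prog} {σ : State} :
      ¬ 0 < e.eval σ → Run (.loop e p) σ (e.cost + 1) σ
  | loop_step {e : Expr} {p : Prog} {σ τ υ : State} {s t : ℕ} :
      0 < e.eval σ → Run p σ s τ → Run (.loop e p) τ t υ →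
        Run (.loop e p) σ (e.cost + 1 + s + t) υ

/-- Programs are deterministic: the halting state and the number of steps are unique. -/
theorem Run.unique {p : Prog} {σ τ τ' : State} {t t' : ℕ}
    (h : Run p σ t τ) (h' : Run p σ t' τ') : t = t' ∧ τ = τ' := by
  induction h generalizing t' τ' with
  | skip => cases h'; exact ⟨rfl, rfl⟩
  | setReg => cases h'; exact ⟨rfl, rfl⟩
  | setArr => cases h'; exact ⟨rfl, rfl⟩
  | seq _ _ ih₁ ih₂ =>
    cases h' with
    | seq k₁ k₂ =>
      obtain ⟨rfl, rfl⟩ := ih₁ k₁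
      obtain ⟨rfl, rfl⟩ := ih₂ k₂
      exact ⟨rfl, rfl⟩
  | ite_pos hc _ ih =>
    cases h' with
    | ite_pos _ k => obtain ⟨rfl, rfl⟩ := ih k; exact ⟨rfl, rfl⟩
    | ite_neg hn _ => exact absurd hc hn
  | ite_neg hc _ ih =>
    cases h' with
    | ite_pos hp _ => exact absurd hp hc
    | ite_neg _ k => obtain ⟨rfl, rfl⟩ := ih k; exact ⟨rfl, rfl⟩
  | loop_done hc =>
    cases h' with
    | loop_done _ => exact ⟨rfl, rfl⟩
    | loop_step hp _ _ => exact absurd hp hc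
  | loop_step hc _ _ ih₁ ih₂ =>
    cases h' with
    | loop_done hn => exact absurd hc hn
    | loop_step _ k₁ k₂ =>
      obtain ⟨rfl, rfl⟩ := ih₁ k₁
      obtain ⟨rfl, rfl⟩ := ih₂ k₂
      exact ⟨rfl, rfl⟩

/-- The initial state on input `(I, i)`: registers `0, 1, 2` hold the number of agents, the bin size
and the (zero-based) index of agent `i`; arrays `0, 1` hold the lengths and the weights of the
agents; everything else is `0`. -/
def input {n : ℕ} (I : Rep n) (i : Fin n) : State where
  reg r := if r = 0 then (n : ℤ) else if r = 1 then (I.bin : ℤ) else if r = 2 then (i.val : ℤ) else 0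
  arr a x :=
    if h : 0 ≤ x ∧ x.toNat < n then
      if a = 0 then (I.len ⟨x.toNat, h.2⟩ : ℤ)
      else if a = 1 then (I.weight ⟨x.toNat, h.2⟩ : ℤ)
      else 0
    else 0

/-- A final state represents the number `x` if `x` is the fraction with numerator in register `0`
and (positive) denominator in register `1`. -/
def State.Outputs (τ : State) (x : ℝ) : Prop :=
  0 < τ.reg 1 ∧ x = (τ.reg 0 : ℝ) / (τ.reg 1 : ℝ)

end GreedyKnapsack

namespace GreedyKnapsack

/-! ### Program logic with step counting -/

/-! The greedy value of a coalition can be read off in one pass through its agents in the greedy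
order, remembering only three numbers: the remaining capacity `b`, the selected weight `x` and the
largest weight `m` seen so far. Setting the capacity to zero at the first misfit closes the bin,
because lengths are positive; at the end the value is `max x m` (`Rep.value_eq_pass`).

Multiplied by `n!`, the Shapley value of `i` is a signed sum over all coalitions: one with `s`
members besides `i` contributes `s! (n-1-s)!` times its value, negatively if `i` is absent
(`Rep.shapley_eq_table`). Selections with the same `s, b, x, m` after an initial stretch of the
order are continued identically by the other agents. So the sum obeys a recursion on the number `p`
of agents still to be considered, with one branch for taking the next agent and one for skipping it
(`Rep.table_eq_sum`).

The coordinates `s, b, x, m` of all entries that matter are below `B = n + l_bin + total weight +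
2`. There are `n + 1` layers of `B^4` entries; an entry takes constant time, except in layer 0,
where a product is formed by `O(B)` additions. This gives `O(n B^5)` steps (`tableProg_spec`), and
`B = O(n l_bin max(1, w_max))` (`Rep.base_succ_le`). Since the machine cannot multiply, addresses
are sums of tabulated multiples of powers of `B`, ratios are compared by products formed through
repeated addition, and so are factorials; all of this is of lower order.

Running times are proved with `Spec`, a total-correctness judgement with a step bound, using the
loop rule `Spec.forUp` and the frame property `Run.agree`. -/

@[simp] theorem State.setReg_reg (σ : State) (r x : ℕ) (z : ℤ) :
    (σ.setReg r z).reg x = if x = r then z else σ.reg x := by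
  simp [State.setReg, Function.update_apply]

@[simp] theorem State.setReg_arr (σ : State) (r : ℕ) (z : ℤ) :
    (σ.setReg r z).arr = σ.arr := rfl

@[simp] theorem State.setArr_reg (σ : State) (a : ℕ) (x z : ℤ) :
    (σ.setArr a x z).reg = σ.reg := rfl

@[simp] theorem State.setArr_arr (σ : State) (a a' : ℕ) (x y z : ℤ) :
    (σ.setArr a x z).arr a' y = if a' = a ∧ y = x then z else σ.arr a' y := by
  by_cases h : a' = a
  · subst h
    simp [State.setArr, Function.update_apply]
  · simp [State.setArr, h]

/-- Whether a program contains an assignment to register `x`. -/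
def Prog.modReg : Prog → ℕ → Bool
  | .skip, _ => false
  | .setReg r _, x => r == x
  | .setArr _ _ _, _ => false
  | .seq p q, x => p.modReg x || q.modReg x
  | .ite _ p q, x => p.modReg x || q.modReg x
  | .loop _ p, x => p.modReg x

/-- Whether a program contains an assignment to a cell of array `x`. -/
def Prog.modArr : Prog → ℕ → Bool
  | .skip, _ => false
  | .setReg _ _, _ => false
  | .setArr a _ _, x => a == x
  | .seq p q, x => p.modArr x || q.modArr x
  | .ite _ p q, x => p.modArr x || q.modArr x
  | .loop _ p, x => p.modArr x

/-- Two states agree on everything that program `p` does not assign. -/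
structure Agree (p : Prog) (σ τ : State) : Prop where
  reg : ∀ r, p.modReg r = false → τ.reg r = σ.reg r
  arr : ∀ a, p.modArr a = false → τ.arr a = σ.arr a

theorem Agree.refl (p : Prog) (σ : State) : Agree p σ σ := ⟨fun _ _ => rfl, fun _ _ => rfl⟩

theorem Agree.trans {p : Prog} {σ τ υ : State} (h : Agree p σ τ) (k : Agree p τ υ) :
    Agree p σ υ :=
  ⟨fun r hr => (k.reg r hr).trans (h.reg r hr), fun a ha => (k.arr a ha).trans (h.arr a ha)⟩

theorem Agree.weaken {p q : Prog} {σ τ : State} (h : Agree p σ τ)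
    (hr : ∀ r, q.modReg r = false → p.modReg r = false)
    (ha : ∀ a, q.modArr a = false → p.modArr a = false) : Agree q σ τ :=
  ⟨fun r h' => h.reg r (hr r h'), fun a h' => h.arr a (ha a h')⟩

/-- The frame property. What a program may change is decided syntactically, so for concrete programs
the side conditions hold by `rfl`. -/
theorem Run.agree {p : Prog} {σ τ : State} {t : ℕ} (h : Run p σ t τ) : Agree p σ τ := by
  induction h with
  | skip => exact Agree.refl _ _
  | setReg σ r e =>
    refine ⟨fun x hx => ?_, fun _ _ => rfl⟩
    have : r ≠ x := by simpa [Prog.modReg] using hx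
    simp [this.symm]
  | setArr σ a e f =>
    refine ⟨fun _ _ => rfl, fun x hx => ?_⟩
    have : a ≠ x := by simpa [Prog.modArr] using hx
    funext y
    simp [this.symm]
  | seq _ _ ih₁ ih₂ =>
    exact (ih₁.weaken (by simp +contextual [Prog.modReg]) (by simp +contextual [Prog.modArr])).trans
      (ih₂.weaken (by simp +contextual [Prog.modReg]) (by simp +contextual [Prog.modArr]))
  | ite_pos _ _ ih =>
    exact ih.weaken (by simp +contextual [Prog.modReg]) (by simp +contextual [Prog.modArr])
  | ite_neg _ _ ih =>
    exact ih.weaken (by simp +contextual [Prog.modReg]) (by simp +contextual [Prog.modArr])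
  | loop_done => exact Agree.refl _ _
  | loop_step _ _ _ ih₁ ih₂ =>
    exact (ih₁.weaken (by simp [Prog.modReg]) (by simp [Prog.modArr])).trans ih₂

/-- Started in `σ`, program `p` halts within `c` steps in a state that satisfies `Q`. -/
def Spec (p : Prog) (c : ℕ) (σ : State) (Q : State → Prop) : Prop :=
  ∃ t τ, Run p σ t τ ∧ t ≤ c ∧ Q τ

namespace Spec

variable {p q : Prog} {σ : State} {c d : ℕ} {Q R : State → Prop}

theorem mono (h : Spec p c σ Q) (hc : c ≤ d) (hQ : ∀ τ, Agree p σ τ → Q τ → R τ) :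
    Spec p d σ R := by
  obtain ⟨t, τ, hr, ht, hq⟩ := h
  exact ⟨t, τ, hr, ht.trans hc, hQ τ hr.agree hq⟩

theorem le (h : Spec p c σ Q) (hc : c ≤ d) : Spec p d σ Q := h.mono hc fun _ _ hq => hq

theorem skip (h : Q σ) : Spec .skip 1 σ Q := ⟨1, σ, .skip σ, le_rfl, h⟩

theorem setReg {r : ℕ} {e : Expr} (h : Q (σ.setReg r (e.eval σ))) :
    Spec (.setReg r e) (e.cost + 1) σ Q :=
  ⟨_, _, .setReg σ r e, le_rfl, h⟩

theorem setArr {a : ℕ} {e f : Expr} (h : Q (σ.setArr a (e.eval σ) (f.eval σ))) :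
    Spec (.setArr a e f) (e.cost + f.cost + 1) σ Q :=
  ⟨_, _, .setArr σ a e f, le_rfl, h⟩

theorem seq (h : Spec p c σ fun τ => Spec q d τ Q) : Spec (.seq p q) (c + d) σ Q := by
  obtain ⟨t, τ, hr, ht, s, υ, hr', hs, hQ⟩ := h
  exact ⟨t + s, υ, .seq hr hr', by omega, hQ⟩

theorem ite {e : Expr} (hp : 0 < e.eval σ → Spec p c σ Q) (hq : ¬ 0 < e.eval σ → Spec q d σ Q) :
    Spec (.ite e p q) (e.cost + 1 + max c d) σ Q := by
  by_cases h : 0 < e.eval σ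
  · obtain ⟨t, τ, hr, ht, hQ⟩ := hp h
    exact ⟨_, τ, .ite_pos h hr, by omega, hQ⟩
  · obtain ⟨t, τ, hr, ht, hQ⟩ := hq h
    exact ⟨_, τ, .ite_neg h hr, by omega, hQ⟩

end Spec

/-- Run `p` for `r = 0, 1, …`, as long as `r` is less than `e`. -/
def Prog.forUp (r : ℕ) (e : Expr) (p : Prog) : Prog :=
  .seq (.setReg r (.lit 0))
    (.loop (.sub e (.reg r)) (.seq p (.setReg r (.add (.reg r) (.lit 1)))))

/-- Induction on the number `m` of rounds left. A test costs `e.cost + 3` steps and the increment of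
the counter 4, hence `e.cost + c + 7` per round and one last test. -/
theorem Spec.forUp_aux {r : ℕ} {e : Expr} {p : Prog} {σ : State} {N c : ℕ}
    (Inv : ℕ → State → Prop)
    (hr : p.modReg r = false)
    (hset : ∀ j τ z, Inv j τ → Inv j (τ.setReg r z))
    (he : ∀ τ, Agree (.forUp r e p) σ τ → e.eval τ = N)
    (hp : ∀ j < N, ∀ τ, Agree (.forUp r e p) σ τ → τ.reg r = j → Inv j τ →
      Spec p c τ (Inv (j + 1)))
    (m : ℕ) : ∀ j, j + m = N → ∀ τ, Agree (.forUp r e p) σ τ → τ.reg r = j → Inv j τ →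
      Spec (.loop (.sub e (.reg r)) (.seq p (.setReg r (.add (.reg r) (.lit 1)))))
        (m * (e.cost + c + 7) + (e.cost + 3)) τ (Inv N) := by
  induction m with
  | zero =>
    intro j hj τ hτ hrj hI
    have h1 : ¬ 0 < (Expr.sub e (.reg r)).eval τ := by
      simp only [Expr.eval, he τ hτ, hrj]; omega
    have hj' : j = N := by omega
    subst hj'
    exact ⟨_, τ, .loop_done h1, by simp [Expr.cost], hI⟩
  | succ m ih =>
    intro j hj τ hτ hrj hI
    have h1 : 0 < (Expr.sub e (.reg r)).eval τ := by
      simp only [Expr.eval, he τ hτ, hrj]; omega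
    obtain ⟨s, υ, hrun, hs, hυ⟩ := hp j (by omega) τ hτ hrj hI
    have hrun' := Run.seq hrun (Run.setReg υ r (.add (.reg r) (.lit 1)))
    have hag : Agree (.forUp r e p) τ (υ.setReg r ((Expr.add (.reg r) (.lit 1)).eval υ)) :=
      hrun'.agree.weaken (by simp +contextual [Prog.modReg, Prog.forUp])
        (by simp +contextual [Prog.modArr, Prog.forUp])
    have hreg : υ.reg r = j := (hrun.agree.reg r hr).trans hrj
    obtain ⟨t, ω, hrun2, ht, hω⟩ := ih (j + 1) (by omega)
      (υ.setReg r ((Expr.add (.reg r) (.lit 1)).eval υ)) (hτ.trans hag)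
      (by simp [Expr.eval, hreg]) (hset _ _ _ hυ)
    refine ⟨_, ω, .loop_step h1 hrun' hrun2, ?_, hω⟩
    simp only [Expr.cost]
    have : (m + 1) * (e.cost + c + 7) = m * (e.cost + c + 7) + (e.cost + c + 7) := by ring
    omega

/-- The invariant rule for counting loops. -/
theorem Spec.forUp {r : ℕ} {e : Expr} {p : Prog} {σ : State} (N : ℕ) {c Y : ℕ}
    (Inv : ℕ → State → Prop)
    (hr : p.modReg r = false)
    (hset : ∀ j τ z, Inv j τ → Inv j (τ.setReg r z))
    (he : ∀ τ, Agree (.forUp r e p) σ τ → e.eval τ = N)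
    (h0 : Inv 0 σ)
    (hp : ∀ j < N, ∀ τ, Agree (.forUp r e p) σ τ → τ.reg r = j → Inv j τ →
      Spec p c τ (Inv (j + 1)))
    (hc : 1 ≤ c) (hecost : e.cost ≤ 10) (hY : N + 1 ≤ Y) :
    Spec (.forUp r e p) (30 * c * Y) σ (Inv N) := by
  have hag : Agree (.forUp r e p) σ (σ.setReg r 0) :=
    (Run.setReg σ r (.lit 0)).agree.weaken (by simp +contextual [Prog.modReg, Prog.forUp])
      (by simp +contextual [Prog.modArr, Prog.forUp])
  have := Spec.forUp_aux Inv hr hset he hp N 0 (by omega) (σ.setReg r 0) hag (by simp)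
    (hset _ _ _ h0)
  refine (Spec.seq (Spec.setReg this)).le ?_
  simp only [Expr.cost]
  -- The factor `N + 1` instead of `N` pays for the initialization and the last test; `c ≥ 1` and
  -- `e.cost ≤ 10` give `e.cost + c + 7 ≤ 30 * c`.
  calc 1 + 1 + (N * (e.cost + c + 7) + (e.cost + 3)) ≤ (N + 1) * (e.cost + c + 7) := by
        have : (N + 1) * (e.cost + c + 7) = N * (e.cost + c + 7) + (e.cost + c + 7) := by ring
        omega
    _ ≤ Y * (30 * c) := Nat.mul_le_mul hY (by omega)
    _ = 30 * c * Y := by ring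

namespace Rep

variable {n : ℕ} (I : Rep n)

/-! ### The order of the agents -/

/-- Agent `j` is considered strictly before agent `k`, without division. -/
def before (j k : Fin n) : Prop :=
  I.weight k * I.len j < I.weight j * I.len k ∨
    (I.weight k * I.len j = I.weight j * I.len k ∧ j < k)

instance : DecidableRel I.before := fun j k =>
  inferInstanceAs (Decidable (I.weight k * I.len j < I.weight j * I.len k ∨
    (I.weight k * I.len j = I.weight j * I.len k ∧ j < k)))

/-- Lengths are positive, so ratios can be compared by cross-multiplication, which avoids division.
-/
theorem before_iff (j k : Fin n) : I.before j k ↔ I.precedes j k ∧ j ≠ k := by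
  have hj : (0 : ℚ) < I.len j := by exact_mod_cast I.len_pos j
  have hk : (0 : ℚ) < I.len k := by exact_mod_cast I.len_pos k
  have h1 : I.ratio k < I.ratio j ↔ I.weight k * I.len j < I.weight j * I.len k := by
    rw [ratio, ratio, div_lt_div_iff₀ hk hj]
    exact_mod_cast Iff.rfl
  have h2 : I.ratio k = I.ratio j ↔ I.weight k * I.len j = I.weight j * I.len k := by
    rw [ratio, ratio, div_eq_div_iff hk.ne' hj.ne']
    exact_mod_cast Iff.rfl
  unfold before precedes
  rw [h1, h2]
  constructor
  · rintro (h | ⟨h, hlt⟩)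
    · exact ⟨.inl h, by rintro rfl; exact lt_irrefl _ h⟩
    · exact ⟨.inr ⟨h, hlt.le⟩, hlt.ne⟩
  · rintro ⟨h | ⟨h, hle⟩, hne⟩
    · exact .inl h
    · exact .inr ⟨h, lt_of_le_of_ne hle hne⟩

theorem before_irrefl (j : Fin n) : ¬ I.before j j := fun h => ((I.before_iff j j).1 h).2 rfl

theorem before_trans {a b c : Fin n} (h : I.before a b) (k : I.before b c) : I.before a c := by
  rw [before_iff] at *
  refine ⟨_root_.trans h.1 k.1, ?_⟩
  rintro rfl
  exact h.2 (antisymm h.1 k.1)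

theorem before_total {a b : Fin n} (h : a ≠ b) : I.before a b ∨ I.before b a := by
  simp only [before_iff]
  rcases total_of I.precedes a b with k | k
  · exact .inl ⟨k, h⟩
  · exact .inr ⟨k, h.symm⟩

/-- The number of agents considered after agent `j`. -/
def rank (j : Fin n) : ℕ := (Finset.univ.filter (I.before j)).card

theorem rank_lt_rank {j k : Fin n} (h : I.before j k) : I.rank k < I.rank j := by
  refine Finset.card_lt_card ⟨fun m hm => ?_, fun hsub => ?_⟩
  · simp only [Finset.mem_filter, Finset.mem_univ, true_and] at hm ⊢
    exact I.before_trans h hm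
  · have := hsub (show k ∈ Finset.univ.filter (I.before j) by simpa using h)
    exact I.before_irrefl k (by simpa using this)

theorem rank_lt (j : Fin n) : I.rank j < n := by
  have : (Finset.univ.filter (I.before j)).card < (Finset.univ : Finset (Fin n)).card := by
    refine Finset.card_lt_card ⟨Finset.subset_univ _, fun hsub => ?_⟩
    exact I.before_irrefl j (by simpa using hsub (Finset.mem_univ j))
  simpa [rank] using this

theorem rank_injective : Function.Injective I.rank := by
  intro j k h
  by_contra hne
  rcases I.before_total hne with hb | hb
  · exact (I.rank_lt_rank hb).ne h.symm
  · exact (I.rank_lt_rank hb).ne h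

/-- The agent of rank `p` (and `i` if there is none). -/
noncomputable def ord (i : Fin n) (p : ℕ) : Fin n :=
  open Classical in if h : ∃ j, I.rank j = p then h.choose else i

theorem ord_rank (i j : Fin n) : I.ord i (I.rank j) = j := by
  have h : ∃ k, I.rank k = I.rank j := ⟨j, rfl⟩
  rw [ord, dif_pos h]
  exact I.rank_injective h.choose_spec

/-- An injection of a finite set into itself is onto, so every rank below `n` is attained and the
default value of `ord` plays no role there. -/
theorem rank_ord (i : Fin n) {p : ℕ} (hp : p < n) : I.rank (I.ord i p) = p := by
  have hbij : Function.Bijective fun j : Fin n => (⟨I.rank j, I.rank_lt j⟩ : Fin n) := by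
    rw [← Finite.injective_iff_bijective]
    intro j k h
    exact I.rank_injective (by simpa using h)
  obtain ⟨j, hj⟩ := hbij.2 ⟨p, hp⟩
  have hj' : I.rank j = p := by simpa using hj
  rw [← hj', ord_rank]

/-- The last `p` agents in the order. -/
noncomputable def lastAgents (i : Fin n) : ℕ → List (Fin n)
  | 0 => []
  | p + 1 => I.ord i p :: lastAgents i p

theorem mem_lastAgents (i : Fin n) {p : ℕ} (hp : p ≤ n) (j : Fin n) :
    j ∈ I.lastAgents i p ↔ I.rank j < p := by
  induction p with
  | zero => simp [lastAgents]
  | succ p ih =>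
    rw [lastAgents, List.mem_cons, ih (by omega), Nat.lt_succ_iff_lt_or_eq, or_comm]
    refine or_congr Iff.rfl ⟨?_, ?_⟩
    · rintro rfl
      exact I.rank_ord i (by omega)
    · rintro rfl
      exact (I.ord_rank i j).symm

theorem ord_notMem_lastAgents (i : Fin n) {p : ℕ} (hp : p < n) :
    I.ord i p ∉ I.lastAgents i p := by
  rw [I.mem_lastAgents i hp.le, I.rank_ord i hp]
  exact lt_irrefl p

theorem toFinset_lastAgents (i : Fin n) : (I.lastAgents i n).toFinset = Finset.univ := by
  ext j
  simp [I.mem_lastAgents i le_rfl, I.rank_lt]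

theorem pairwise_lastAgents (i : Fin n) {p : ℕ} (hp : p ≤ n) :
    (I.lastAgents i p).Pairwise I.before := by
  induction p with
  | zero => simp [lastAgents]
  | succ p ih =>
    rw [lastAgents, List.pairwise_cons]
    refine ⟨fun k hk => ?_, ih (by omega)⟩
    rw [I.mem_lastAgents i (by omega)] at hk
    have hr := I.rank_ord i (p := p) (by omega)
    have hne : I.ord i p ≠ k := by
      rintro rfl
      omega
    rcases I.before_total hne with h | h
    · exact h
    · have := I.rank_lt_rank h
      omega

/-- Both lists are sorted by the same antisymmetric relation and have the same members without
repetition, which determines them. -/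
theorem sorted_eq_filter (i : Fin n) (S : Finset (Fin n)) :
    I.sorted S = (I.lastAgents i n).filter (· ∈ S) := by
  have hp := I.pairwise_lastAgents i le_rfl
  have hnd : (I.lastAgents i n).Nodup := hp.imp fun h => ((I.before_iff _ _).1 h).2
  refine List.Perm.eq_of_pairwise' (r := I.precedes) (Finset.pairwise_sort _ _)
    ((hp.imp fun h => ((I.before_iff _ _).1 h).1).filter _) ?_
  refine (List.perm_ext_iff_of_nodup (Finset.sort_nodup _ _) (hnd.filter _)).2 fun a => ?_
  simp [I.mem_lastAgents i le_rfl, I.rank_lt]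

/-! ### The greedy value by a single pass -/

/-- The remaining capacity after considering agent `k`; it is zero once the bin is closed. -/
def nextCap (k : Fin n) (b : ℕ) : ℕ := if I.len k ≤ b then b - I.len k else 0

/-- The selected weight after considering agent `k`. -/
def nextWeight (k : Fin n) (b x : ℕ) : ℕ := if I.len k ≤ b then x + I.weight k else x

/-- The value found by passing through a list with remaining capacity `b`, selected weight `x` and
maximum weight `m` so far. -/
def pass : List (Fin n) → ℕ → ℕ → ℕ → ℕ
  | [], _, x, m => max x m
  | k :: ks, b, x, m => pass ks (I.nextCap k b) (I.nextWeight k b x) (max m (I.weight k))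

theorem fill_zero (ks : List (Fin n)) : I.fill ks 0 = [] := by
  cases ks with
  | nil => rfl
  | cons k ks => simp [fill, (I.len_pos k).ne']

/-- At the first misfit the capacity drops to 0, and `fill` selects nothing from then on because no
length is 0. -/
theorem pass_eq (ks : List (Fin n)) (b x m : ℕ) :
    I.pass ks b x m = max (x + ((I.fill ks b).map I.weight).sum)
      (max m ((ks.map I.weight).foldr max 0)) := by
  induction ks generalizing b x m with
  | nil => simp [pass, fill]
  | cons k ks ih =>
    rw [pass, ih]
    by_cases h : I.len k ≤ b
    · simp [nextCap, nextWeight, fill, h, add_assoc, max_assoc]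
    · simp [nextCap, nextWeight, fill, h, I.fill_zero, max_assoc]

theorem fill_sublist (ks : List (Fin n)) (b : ℕ) : (I.fill ks b).Sublist ks := by
  induction ks generalizing b with
  | nil => simp [fill]
  | cons k ks ih =>
    rw [fill]
    split
    · exact (ih _).cons_cons k
    · exact List.nil_sublist _

theorem foldr_max_eq {ks : List (Fin n)} {a : Fin n} (ha : a ∈ ks)
    (hmax : ∀ k ∈ ks, I.weight k ≤ I.weight a) :
    (ks.map I.weight).foldr max 0 = I.weight a := by
  apply le_antisymm
  · clear ha
    induction ks with
    | nil => simp
    | cons k ks ih =>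
      simp only [List.map_cons, List.foldr_cons, max_le_iff]
      exact ⟨hmax k (by simp), ih fun k hk => hmax k (by simp [hk])⟩
  · clear hmax
    induction ks with
    | nil => simp at ha
    | cons k ks ih =>
      simp only [List.map_cons, List.foldr_cons, le_max_iff]
      rcases List.mem_cons.1 ha with rfl | h
      · exact .inl le_rfl
      · exact .inr (ih h)

/-- The heuristic keeps the heavier of `S'` and `{a}`, so only the maximum of the two weights
matters, not which agent attains the largest weight. -/
theorem value_eq_pass (S : Finset (Fin n)) :
    I.value S = I.pass (I.sorted S) I.bin 0 0 := by
  have hsum : ∑ k ∈ (I.fill (I.sorted S) I.bin).toFinset, I.weight k =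
      ((I.fill (I.sorted S) I.bin).map I.weight).sum := by
    rw [List.sum_toFinset]
    exact (I.fill_sublist _ _).nodup (Finset.sort_nodup _ _)
  rw [pass_eq]
  unfold value greedy
  cases h : (I.sorted S).argmax I.weight with
  | none =>
    rw [List.argmax_eq_none] at h
    simp [h, fill]
  | some a =>
    have ha : a ∈ (I.sorted S).argmax I.weight := by simp [h]
    rw [I.foldr_max_eq (List.argmax_mem ha) fun k hk => List.le_of_mem_argmax hk ha]
    simp only [hsum, zero_add, zero_le, max_eq_right]
    split_ifs with hle
    · rw [max_eq_left hle, ← hsum]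
      push_cast
      rfl
    · rw [max_eq_right (by omega)]
      simp

/-! ### The recursion -/

/-- The numerator of the coefficient of a coalition of size `s` in the Shapley value. -/
def coeff (n s : ℕ) : ℤ := if s < n then (s.factorial * (n - 1 - s).factorial : ℕ) else 0

/-- The contribution to the Shapley value of agent `i` (times `n!`) of the ways to extend a
selection from the first agents by some of the last `p` agents, if the selection has `s` agents
besides `i` and leads to remaining capacity `b`, selected weight `x` and maximum weight `m`. -/
noncomputable def table (i : Fin n) : ℕ → ℕ → ℕ → ℕ → ℕ → ℤ
  | 0, s, _, x, m => coeff n s * (max x m : ℕ)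
  | p + 1, s, b, x, m =>
    if I.ord i p = i then
      table i p s (I.nextCap (I.ord i p) b) (I.nextWeight (I.ord i p) b x)
        (max m (I.weight (I.ord i p))) - table i p s b x m
    else
      table i p (s + 1) (I.nextCap (I.ord i p) b) (I.nextWeight (I.ord i p) b x)
        (max m (I.weight (I.ord i p))) + table i p s b x m

/-- The subsets of the last `p + 1` agents are split by whether they contain the first of these
agents, `a`. If they do not, the pass is unchanged, and the sign flips when `a = i` (`e1`). If they
do, the pass makes one step with `a`, and the size grows unless `a = i` (`e2`). -/
theorem table_eq_sum (i : Fin n) {p : ℕ} (hp : p ≤ n) (s b x m : ℕ) :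
    I.table i p s b x m = ∑ S ∈ (I.lastAgents i p).toFinset.powerset,
      (∏ k ∈ (I.lastAgents i p).toFinset \ S, if k = i then (-1 : ℤ) else 1) *
        coeff n (s + ∑ k ∈ S, if k = i then 0 else 1) *
        (I.pass ((I.lastAgents i p).filter (· ∈ S)) b x m : ℕ) := by
  induction p generalizing s b x m with
  | zero => simp [table, lastAgents, pass]
  | succ p ih =>
    have hn := I.ord_notMem_lastAgents i (p := p) (by omega)
    have hn' : I.ord i p ∉ (I.lastAgents i p).toFinset := by simpa using hn
    rw [lastAgents, List.toFinset_cons, Finset.sum_powerset_insert hn', table,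
      ih (by omega), ih (by omega), ih (by omega)]
    set a := I.ord i p with ha
    set L := I.lastAgents i p with hL
    have e1 : ∀ S ∈ L.toFinset.powerset,
        (∏ k ∈ insert a L.toFinset \ S, if k = i then (-1 : ℤ) else 1) *
          coeff n (s + ∑ k ∈ S, if k = i then 0 else 1) *
          (I.pass ((a :: L).filter (· ∈ S)) b x m : ℕ) =
        (if a = i then -1 else 1) *
        ((∏ k ∈ L.toFinset \ S, if k = i then (-1 : ℤ) else 1) *
          coeff n (s + ∑ k ∈ S, if k = i then 0 else 1) *
          (I.pass (L.filter (· ∈ S)) b x m : ℕ)) := by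
      intro S hS
      have haS : a ∉ S := fun h => hn' (Finset.mem_powerset.1 hS h)
      rw [Finset.insert_sdiff_of_notMem _ haS, Finset.prod_insert (by simp [hn]),
        List.filter_cons_of_neg (by simpa using haS)]
      ring
    have e2 : ∀ S ∈ L.toFinset.powerset,
        (∏ k ∈ insert a L.toFinset \ insert a S, if k = i then (-1 : ℤ) else 1) *
          coeff n (s + ∑ k ∈ insert a S, if k = i then 0 else 1) *
          (I.pass ((a :: L).filter (· ∈ insert a S)) b x m : ℕ) =
        (∏ k ∈ L.toFinset \ S, if k = i then (-1 : ℤ) else 1) *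
          coeff n ((s + if a = i then 0 else 1) + ∑ k ∈ S, if k = i then 0 else 1) *
          (I.pass (L.filter (· ∈ S)) (I.nextCap a b) (I.nextWeight a b x)
            (max m (I.weight a)) : ℕ) := by
      intro S hS
      have haS : a ∉ S := fun h => hn' (Finset.mem_powerset.1 hS h)
      have hd : insert a L.toFinset \ insert a S = L.toFinset \ S := by
        ext k
        simp only [Finset.mem_sdiff, Finset.mem_insert]
        by_cases h : k = a
        · subst h
          simp [hn]
        · simp [h]
      have hf : L.filter (· ∈ insert a S) = L.filter (· ∈ S) := by
        refine List.filter_congr fun k hk => ?_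
        have : k ≠ a := by
          rintro rfl
          exact hn hk
        simp [this]
      rw [hd, Finset.sum_insert haS, List.filter_cons_of_pos (by simp), hf, pass, add_assoc]
    rw [Finset.sum_congr rfl e1, Finset.sum_congr rfl e2, ← Finset.mul_sum]
    split_ifs with h
    · simp only [add_zero]
      ring
    · ring

/-- The coalitions are paired as `S` and `insert i S` with `i ∉ S`. Both have `S.card` members
besides `i`, hence the same coefficient; the product over the complement is `-1` for the first and
`1` for the second. -/
theorem shapley_eq_table (i : Fin n) :
    shapley I.value i = (I.table i n 0 I.bin 0 0 : ℝ) / (n.factorial : ℝ) := by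
  rw [I.table_eq_sum i le_rfl, I.toFinset_lastAgents]
  simp only [← I.sorted_eq_filter]
  have hu : (Finset.univ : Finset (Fin n)) = insert i (Finset.univ.erase i) := by simp
  have key : ∀ S ∈ (Finset.univ.erase i).powerset,
      ((S.card.factorial : ℝ) * ((Fintype.card (Fin n) - S.card - 1).factorial : ℝ)
        / ((Fintype.card (Fin n)).factorial : ℝ)) * (I.value (insert i S) - I.value S) =
      (((∏ k ∈ Finset.univ \ S, if k = i then (-1 : ℤ) else 1) *
        coeff n (0 + ∑ k ∈ S, if k = i then 0 else 1) *
        (I.pass (I.sorted S) I.bin 0 0 : ℕ) +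
      (∏ k ∈ Finset.univ \ insert i S, if k = i then (-1 : ℤ) else 1) *
        coeff n (0 + ∑ k ∈ insert i S, if k = i then 0 else 1) *
        (I.pass (I.sorted (insert i S)) I.bin 0 0 : ℕ) : ℤ) : ℝ) / (n.factorial : ℝ) := by
    intro S hS
    have hiS : i ∉ S := fun h => by simpa using Finset.mem_powerset.1 hS h
    have hcard : S.card < n := by
      have := Finset.card_lt_card (Finset.ssubset_univ_iff.2 fun h : S = Finset.univ =>
        hiS (h ▸ Finset.mem_univ i))
      simpa using this
    have hs : (∑ k ∈ S, if k = i then 0 else 1) = S.card := by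
      rw [Finset.card_eq_sum_ones]
      refine Finset.sum_congr rfl fun k hk => if_neg ?_
      rintro rfl
      exact hiS hk
    rw [Finset.sum_insert hiS, hs, Finset.prod_ite_eq', Finset.prod_ite_eq', if_pos rfl,
      if_pos (by simpa using hiS), if_neg (by simp), value_eq_pass, value_eq_pass]
    simp only [coeff, Fintype.card_fin, zero_add, if_pos hcard]
    rw [show n - S.card - 1 = n - 1 - S.card by omega]
    push_cast
    ring
  rw [shapley, Finset.sum_congr rfl key, ← Finset.sum_div]
  congr 1
  conv_rhs => rw [show (Finset.univ : Finset (Fin n)).powerset =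
    (insert i (Finset.univ.erase i)).powerset from by rw [← hu]]
  rw [Finset.sum_powerset_insert (by simp), ← Finset.sum_add_distrib]
  push_cast
  rfl

end Rep

/-! ### Sequencing rules and multiplication by repeated addition -/

open Prog

theorem Spec.seq_of {p q : Prog} {σ : State} {c d e : ℕ} {Q R : State → Prop}
    (h : Spec p c σ R) (hq : ∀ τ, Agree p σ τ → R τ → Spec q d τ Q) (hc : c + d ≤ e) :
    Spec (.seq p q) e σ Q :=
  (Spec.seq (h.mono le_rfl fun τ ha hR => hq τ ha hR)).le hc

theorem Spec.seq_setReg {q : Prog} {σ : State} {r : ℕ} {e : Expr} {c d : ℕ} {Q : State → Prop}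
    (h : Spec q d (σ.setReg r (e.eval σ)) Q) (hc : e.cost + 1 + d ≤ c) :
    Spec (.seq (.setReg r e) q) c σ Q :=
  (Spec.seq (Spec.setReg h)).le hc

/-- Add `f` to register `c` as often as `e` says. -/
def Prog.accumulate (r c : ℕ) (e f : Expr) : Prog :=
  .forUp r e (.setReg c (.add (.reg c) f))

/-- The time depends only on the number `N` of repetitions; the summand `F` may be negative or
arbitrarily large, since an addition is one step. -/
theorem Spec.accumulate {r c : ℕ} {e f : Expr} {σ : State} (N : ℕ) (F : ℤ) {Y : ℕ} (hrc : c ≠ r)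
    (he : ∀ τ, Agree (.accumulate r c e f) σ τ → e.eval τ = N)
    (hf : ∀ τ, Agree (.accumulate r c e f) σ τ → f.eval τ = F)
    (hecost : e.cost ≤ 10) (hfcost : f.cost ≤ 10) (hY : N + 1 ≤ Y) :
    Spec (.accumulate r c e f) (400 * Y) σ fun τ => τ.reg c = σ.reg c + N * F := by
  refine (Spec.forUp N (c := 13) (Y := Y) (fun j τ => τ.reg c = σ.reg c + j * F) ?_ ?_ he ?_ ?_
    (by norm_num) hecost hY).le (by omega)
  · simp [modReg, hrc]
  · intro j τ z h
    simpa [hrc] using h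
  · simp
  · intro j hj τ ha hr h
    refine (Spec.setReg ?_).le (by simp only [Expr.cost]; omega)
    simp only [State.setReg_reg, if_true, Expr.eval, h, hf τ ha]
    push_cast
    ring

/-! ### The input in memory and the range of the coordinates -/

namespace Rep

variable {n : ℕ} (I : Rep n) (i : Fin n)

/-- The input is in place. -/
structure HasInput (σ : State) : Prop where
  num : σ.reg 0 = n
  bin : σ.reg 1 = I.bin
  agent : σ.reg 2 = i.val
  len : ∀ k : Fin n, σ.arr 0 k.val = I.len k
  weight : ∀ k : Fin n, σ.arr 1 k.val = I.weight k

theorem hasInput_input : I.HasInput i (input I i) := by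
  constructor <;> simp [input]

variable {I i}

theorem HasInput.of_agree {p : Prog} {σ τ : State} (h : I.HasInput i σ) (ha : Agree p σ τ)
    (h0 : p.modReg 0 = false := by rfl) (h1 : p.modReg 1 = false := by rfl)
    (h2 : p.modReg 2 = false := by rfl) (k0 : p.modArr 0 = false := by rfl)
    (k1 : p.modArr 1 = false := by rfl) : I.HasInput i τ where
  num := (ha.reg 0 h0).trans h.num
  bin := (ha.reg 1 h1).trans h.bin
  agent := (ha.reg 2 h2).trans h.agent
  len k := by rw [ha.arr 0 k0, h.len]
  weight k := by rw [ha.arr 1 k1, h.weight]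

variable (I)

/-- The total weight of all agents. -/
def total : ℕ := ∑ k, I.weight k

/-- A number larger than all coordinates in the table. -/
def base : ℕ := n + I.bin + I.total + 2

end Rep

/-! ### The total weight and the multiplication tables -/

/-- Put the total weight into register `3`. -/
def sumProg : Prog := .accumulate 5 3 (.reg 0) (.get 1 (.reg 5))

/-- The summand varies with the loop counter, so the general loop rule is used in place of
`Spec.accumulate`. -/
theorem sumProg_spec {n : ℕ} {I : Rep n} {i : Fin n} {σ : State} {Y : ℕ} (h : I.HasInput i σ)
    (h3 : σ.reg 3 = 0) (hY : I.base + 1 ≤ Y) :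
    Spec sumProg (400 * Y) σ fun τ => τ.reg 3 = I.total := by
  have hn : n + 1 ≤ Y := by
    unfold Rep.base at hY
    omega
  refine (Spec.forUp n (c := 10) (Y := Y) (fun j τ => τ.reg 3 = ∑ k ∈ Finset.range j, σ.arr 1 k)
    rfl ?_ ?_ ?_ ?_ (by norm_num) (by simp [Expr.cost]) hn).mono (by omega) ?_
  · intro j τ z hj
    simpa using hj
  · intro τ ha
    exact (h.of_agree ha).num
  · simp [h3]
  · intro j hj τ ha hr hI
    refine (Spec.setReg ?_).le (by simp [Expr.cost])
    simp [Expr.eval, hI, hr, Finset.sum_range_succ, ha.arr 1 rfl]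
  · intro τ _ hτ
    rw [hτ, Finset.sum_range, Rep.total]
    push_cast
    exact Finset.sum_congr rfl fun k _ => h.weight k

/-- Put the multiples of register `7` into array `a`, and multiply register `7` by register `4`. -/
def tabProg (a : ℕ) : Prog :=
  .seq (.setReg 6 (.lit 0)) (.seq
    (.forUp 5 (.reg 4) (.seq (.setArr a (.reg 5) (.reg 6)) (.setReg 6 (.add (.reg 6) (.reg 7)))))
    (.setReg 7 (.reg 6)))

/-- Register `7` ends with `B * D`, so consecutive calls tabulate the multiples of consecutive
powers of `B`. -/
theorem tabProg_spec {a B : ℕ} {σ : State} {D : ℤ} {Y : ℕ} (h4 : σ.reg 4 = B) (h7 : σ.reg 7 = D)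
    (hY : B + 1 ≤ Y) :
    Spec (tabProg a) (1000 * Y) σ fun τ =>
      τ.reg 7 = B * D ∧ ∀ x : ℕ, x < B → τ.arr a x = x * D := by
  refine Spec.seq_setReg (d := 990 * Y) ?_ (by simp only [Expr.cost]; omega)
  refine Spec.seq_of (d := 2)
    (Spec.forUp B (c := 7) (Y := Y)
      (fun j τ => τ.reg 6 = j * D ∧ ∀ x : ℕ, x < j → τ.arr a x = x * D)
      rfl ?_ ?_ ?_ ?_ (by norm_num) (by simp [Expr.cost]) hY) ?_ (by omega)
  · rintro j τ z ⟨hj, hk⟩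
    exact ⟨by simpa using hj, hk⟩
  · intro τ ha
    simpa [Expr.eval, h4] using ha.reg 4 rfl
  · simp [Expr.eval]
  · rintro j hj τ ha hr ⟨hI, hT⟩
    have e7 : τ.reg 7 = D := by simpa [h7] using ha.reg 7 rfl
    refine Spec.seq (Spec.setArr (Spec.setReg ?_))
    refine ⟨?_, ?_⟩
    · simp only [Expr.eval, State.setReg_reg, if_true, State.setArr_reg, hI, e7]
      push_cast
      ring
    · intro x hx
      simp only [Expr.eval, State.setReg_arr, State.setArr_arr, hr, hI, true_and, Nat.cast_inj]
      split_ifs with hxj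
      · rw [hxj]
      · exact hT x (by omega)
  · rintro τ _ ⟨hI, hT⟩
    refine Spec.setReg ?_
    simp only [Expr.eval, State.setReg_reg, if_true, State.setReg_arr]
    exact ⟨hI, hT⟩

/-- Compute the base and the multiplication tables for its powers. -/
def setupProg : Prog :=
  .seq sumProg (.seq
    (.setReg 4 (.add (.add (.add (.reg 0) (.reg 1)) (.reg 3)) (.lit 2))) (.seq
    (.setReg 7 (.reg 4)) (.seq
    (tabProg 11) (.seq (tabProg 12) (.seq (tabProg 13) (tabProg 14))))))

/-- The base and the multiplication tables are in place. -/
structure HasTables (B : ℕ) (σ : State) : Prop where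
  base : σ.reg 4 = B
  one : ∀ x : ℕ, x < B → σ.arr 11 x = x * B
  two : ∀ x : ℕ, x < B → σ.arr 12 x = x * (B * B)
  three : ∀ x : ℕ, x < B → σ.arr 13 x = x * (B * (B * B))
  four : ∀ x : ℕ, x < B → σ.arr 14 x = x * (B * (B * (B * B)))

theorem HasTables.of_agree {B : ℕ} {p : Prog} {σ τ : State} (h : HasTables B σ) (ha : Agree p σ τ)
    (h4 : p.modReg 4 = false := by rfl) (k1 : p.modArr 11 = false := by rfl)
    (k2 : p.modArr 12 = false := by rfl) (k3 : p.modArr 13 = false := by rfl)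
    (k4 : p.modArr 14 = false := by rfl) : HasTables B τ where
  base := (ha.reg 4 h4).trans h.base
  one := by rw [ha.arr 11 k1]; exact h.one
  two := by rw [ha.arr 12 k2]; exact h.two
  three := by rw [ha.arr 13 k3]; exact h.three
  four := by rw [ha.arr 14 k4]; exact h.four

theorem setupProg_spec {n : ℕ} {I : Rep n} {i : Fin n} {σ : State} {Y : ℕ} (h : I.HasInput i σ)
    (h3 : σ.reg 3 = 0) (hY : I.base + 1 ≤ Y) :
    Spec setupProg (5000 * Y) σ fun τ => HasTables I.base τ := by
  refine Spec.seq_of (d := 4550 * Y) (sumProg_spec h h3 hY) ?_ (by omega)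
  intro τ ha ht
  have hi := h.of_agree ha
  refine Spec.seq_setReg (d := 4530 * Y) ?_ (by simp only [Expr.cost]; omega)
  refine Spec.seq_setReg (d := 4500 * Y) ?_ (by simp only [Expr.cost]; omega)
  set υ := (τ.setReg 4 _).setReg 7 _ with hυ
  have hB : ((n : ℤ) + I.bin + I.total + 2) = (I.base : ℕ) := by
    simp [Rep.base]
  have h4 : υ.reg 4 = I.base := by
    simp [hυ, Expr.eval, hi.num, hi.bin, ht, hB]
  have h7 : υ.reg 7 = I.base := by
    simp [hυ, Expr.eval, hi.num, hi.bin, ht, hB]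
  clear_value υ
  refine Spec.seq_of (d := 3500 * Y) (tabProg_spec h4 h7 hY) ?_ (by omega)
  rintro τ₁ a₁ ⟨r₁, t₁⟩
  have b₁ : τ₁.reg 4 = I.base := (a₁.reg 4 rfl).trans h4
  refine Spec.seq_of (d := 2500 * Y) (tabProg_spec b₁ r₁ hY) ?_ (by omega)
  rintro τ₂ a₂ ⟨r₂, t₂⟩
  have b₂ : τ₂.reg 4 = I.base := (a₂.reg 4 rfl).trans b₁
  refine Spec.seq_of (d := 1500 * Y) (tabProg_spec b₂ r₂ hY) ?_ (by omega)
  rintro τ₃ a₃ ⟨r₃, t₃⟩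
  have b₃ : τ₃.reg 4 = I.base := (a₃.reg 4 rfl).trans b₂
  refine (tabProg_spec b₃ r₃ hY).mono (by omega) ?_
  rintro τ₄ a₄ ⟨r₄, t₄⟩
  refine ⟨(a₄.reg 4 rfl).trans b₃, ?_, ?_, ?_, t₄⟩
  · rw [a₄.arr 11 rfl, a₃.arr 11 rfl, a₂.arr 11 rfl]; exact t₁
  · rw [a₄.arr 12 rfl, a₃.arr 12 rfl]; exact t₂
  · rw [a₄.arr 13 rfl]; exact t₃

/-! ### The order of the agents -/

/-- Increase register `6` if agent `j` in register `5` comes before agent `k` in register `7`. -/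
def compareProg : Prog :=
  .seq (.setReg 8 (.lit 0)) (.seq
    (.accumulate 9 8 (.get 0 (.reg 5)) (.get 1 (.reg 7))) (.seq
    (.accumulate 9 8 (.get 0 (.reg 7)) (.sub (.lit 0) (.get 1 (.reg 5))))
    (.ite (.sub (.lit 0) (.reg 8)) (.setReg 6 (.add (.reg 6) (.lit 1)))
      (.ite (.reg 8) .skip
        (.ite (.sub (.reg 7) (.reg 5)) (.setReg 6 (.add (.reg 6) (.lit 1))) .skip)))))

/-- Register `8` receives the difference of the two cross products, whose sign decides the order,
with ties left to the indices. The lengths are the repetition counts and are bounded by the bin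
size. -/
theorem compareProg_spec {n : ℕ} {I : Rep n} {i : Fin n} {σ : State} {Y : ℕ}
    (h : I.HasInput i σ) (hY : I.base + 1 ≤ Y) (j k : Fin n) (h5 : σ.reg 5 = j.val)
    (h7 : σ.reg 7 = k.val) :
    Spec compareProg (1000 * Y) σ fun τ =>
      τ.reg 6 = σ.reg 6 + if I.before j k then 1 else 0 := by
  have hlen : ∀ m, I.len m + 1 ≤ Y := fun m => by
    have := I.len_le_bin m
    unfold Rep.base at hY
    omega
  refine Spec.seq_setReg (d := 900 * Y) ?_ (by simp only [Expr.cost]; omega)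
  refine Spec.seq_of (d := 500 * Y) (Spec.accumulate (Y := Y) (I.len j) (I.weight k) (by norm_num)
    ?_ ?_ (by simp [Expr.cost]) (by simp [Expr.cost]) (hlen j)) ?_ (by omega)
  · intro τ ha
    simp [Expr.eval, ha.arr 0 rfl, ha.reg 5 rfl, h5, h.len]
  · intro τ ha
    simp [Expr.eval, ha.arr 1 rfl, ha.reg 7 rfl, h7, h.weight]
  intro τ aτ hτ
  refine Spec.seq_of (d := 30 * Y) (Spec.accumulate (Y := Y) (I.len k) (-I.weight j) (by norm_num)
    ?_ ?_ (by simp [Expr.cost]) (by simp [Expr.cost]) (hlen k)) ?_ (by omega)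
  · intro υ ha
    simp [Expr.eval, ha.arr 0 rfl, ha.reg 7 rfl, aτ.arr 0 rfl, aτ.reg 7 rfl, h7, h.len]
  · intro υ ha
    simp [Expr.eval, ha.arr 1 rfl, ha.reg 5 rfl, aτ.arr 1 rfl, aτ.reg 5 rfl, h5, h.weight]
  intro υ aυ hυ
  have e5 : υ.reg 5 = j.val := by rw [aυ.reg 5 rfl, aτ.reg 5 rfl]; simpa using h5
  have e7 : υ.reg 7 = k.val := by rw [aυ.reg 7 rfl, aτ.reg 7 rfl]; simpa using h7
  have e6 : υ.reg 6 = σ.reg 6 := by rw [aυ.reg 6 rfl, aτ.reg 6 rfl]; simp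
  have e8 : υ.reg 8 = (I.weight k * I.len j : ℕ) - (I.weight j * I.len k : ℕ) := by
    rw [hυ, hτ]
    simp [Expr.eval]
    ring
  have hb : I.before j k ↔ I.weight k * I.len j < I.weight j * I.len k ∨
      (I.weight k * I.len j = I.weight j * I.len k ∧ j.val < k.val) := Iff.rfl
  refine (Spec.ite (c := 4) (d := 20) ?_ ?_).le (by simp only [Expr.cost]; omega)
  · intro hc
    simp only [Expr.eval, e8] at hc
    refine Spec.setReg ?_
    rw [if_pos (hb.2 (by omega))]
    simp [Expr.eval, e6]
  intro hc
  simp only [Expr.eval, e8] at hc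
  refine (Spec.ite (c := 1) (d := 10) ?_ ?_).le (by simp [Expr.cost])
  · intro hd
    simp only [Expr.eval, e8] at hd
    refine Spec.skip ?_
    rw [if_neg (by rw [hb]; omega)]
    simp [e6]
  intro hd
  simp only [Expr.eval, e8] at hd
  refine (Spec.ite (c := 4) (d := 1) ?_ ?_).le (by simp [Expr.cost])
  · intro he
    simp only [Expr.eval, e5, e7] at he
    refine Spec.setReg ?_
    rw [if_pos (hb.2 (by omega))]
    simp [Expr.eval, e6]
  · intro he
    simp only [Expr.eval, e5, e7] at he
    refine Spec.skip ?_
    rw [if_neg (by rw [hb]; omega)]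
    simp [e6]

/-- Put the agents into array `2`, in the order of their ranks. -/
def ordProg : Prog :=
  .forUp 5 (.reg 0) (.seq (.setReg 6 (.lit 0)) (.seq
    (.forUp 7 (.reg 0) compareProg) (.setArr 2 (.reg 6) (.reg 5))))

/-- The rank of each agent is found by counting the agents after it, which sorts without moving data
and takes `n^2` comparisons. -/
theorem ordProg_spec {n : ℕ} {I : Rep n} {i : Fin n} {σ : State} {Y : ℕ}
    (h : I.HasInput i σ) (hY : I.base + 1 ≤ Y) :
    Spec ordProg (1000000 * Y * Y * Y) σ fun τ => ∀ p < n, τ.arr 2 p = (I.ord i p).val := by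
  have hn : n + 1 ≤ Y := by
    unfold Rep.base at hY
    omega
  have hYY : Y ≤ Y * Y := Nat.le_mul_self Y
  refine (Spec.forUp n (c := 31000 * (Y * Y)) (Y := Y)
    (fun j τ => ∀ k : Fin n, k.val < j → τ.arr 2 (I.rank k) = k.val) rfl ?_ ?_ ?_ ?_
    (by nlinarith) (by simp [Expr.cost]) hn).mono (by nlinarith) ?_
  · intro j τ z hj
    simpa using hj
  · intro τ ha
    exact (h.of_agree ha).num
  · intro k hk
    omega
  · intro j hj τ ha hr hI
    have hin := h.of_agree ha
    refine Spec.seq_setReg (d := 30500 * (Y * Y)) ?_ (by simp only [Expr.cost]; nlinarith)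
    refine Spec.seq_of (d := 3) (Spec.forUp n (c := 1000 * Y) (Y := Y)
      (fun m υ => υ.reg 6 = ∑ k ∈ Finset.range m,
        if hk : k < n then (if I.before ⟨j, hj⟩ ⟨k, hk⟩ then 1 else 0) else 0)
      rfl ?_ ?_ ?_ ?_ (by omega) (by simp [Expr.cost]) hn) ?_ (by nlinarith)
    · intro m υ z hm
      simpa using hm
    · intro υ hυ
      have := hυ.reg 0 rfl
      simpa [Expr.eval, hin.num] using this
    · simp [Expr.eval]
    · intro m hm υ aυ hrυ hIυ
      have hin' : I.HasInput i υ :=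
        Rep.HasInput.of_agree (hin.of_agree (Run.setReg τ 6 (.lit 0)).agree) aυ
      have e5 : υ.reg 5 = j := by
        rw [aυ.reg 5 rfl]
        simpa using hr
      refine (compareProg_spec hin' hY ⟨j, hj⟩ ⟨m, hm⟩ e5 hrυ).mono le_rfl ?_
      intro ω _ hω
      rw [hω, hIυ, Finset.sum_range_succ, dif_pos hm]
    · intro υ aυ hυ
      refine Spec.setArr ?_
      have e6 : υ.reg 6 = I.rank ⟨j, hj⟩ := by
        rw [hυ, Finset.sum_range, Rep.rank, Finset.card_filter]
        simp
      have e5 : υ.reg 5 = j := by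
        rw [aυ.reg 5 rfl]
        simpa using hr
      intro k hk
      simp only [Expr.eval, State.setArr_arr, e5, e6, true_and, Nat.cast_inj]
      -- Ranks are distinct, so a later write never overwrites an earlier one.
      split_ifs with hkj
      · rw [I.rank_injective hkj]
      · rw [aυ.arr 2 rfl]
        refine hI k ?_
        have : k.val ≠ j := by
          rintro rfl
          exact hkj rfl
        omega
  · intro τ _ hτ p hp
    have := hτ (I.ord i p) (I.ord i p).isLt
    rwa [I.rank_ord i hp] at this

/-! ### The coefficients -/

/-- Multiply register `6` by the factorial of register `7`. -/
def factProg : Prog :=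
  .forUp 8 (.reg 7) (.seq (.setReg 9 (.lit 0)) (.seq
    (.accumulate 10 9 (.add (.reg 8) (.lit 1)) (.reg 6)) (.setReg 6 (.reg 9))))

/-- The small factor `j + 1` is the repetition count and the large partial product is the summand,
so the time stays quadratic. -/
theorem factProg_spec {N Y : ℕ} {σ : State} (h7 : σ.reg 7 = N) (hY : N + 1 ≤ Y) :
    Spec factProg (15000 * (Y * Y)) σ fun τ => τ.reg 6 = σ.reg 6 * N.factorial := by
  refine (Spec.forUp N (c := 410 * Y) (Y := Y)
    (fun j τ => τ.reg 6 = σ.reg 6 * j.factorial) rfl ?_ ?_ ?_ ?_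
    (by omega) (by simp [Expr.cost]) hY).le (by nlinarith)
  · intro j τ z hj
    simpa using hj
  · intro τ ha
    exact (ha.reg 7 rfl).trans h7
  · simp
  · intro j hj τ ha hr hI
    refine Spec.seq_setReg (d := 405 * Y) ?_ (by simp only [Expr.cost]; omega)
    refine Spec.seq_of (d := 2) (Spec.accumulate (Y := Y) (j + 1) (τ.reg 6) (by norm_num)
      ?_ ?_ (by simp [Expr.cost]) (by simp [Expr.cost]) (by omega)) ?_ (by omega)
    · intro υ hυ
      simp [Expr.eval, hυ.reg 8 rfl, hr]
    · intro υ hυ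
      simp [Expr.eval, hυ.reg 6 rfl]
    · intro υ _ hυ
      refine Spec.setReg ?_
      simp only [Expr.eval, State.setReg_reg, if_true, hυ, hI, Nat.factorial_succ]
      push_cast
      simp
      ring

/-- Put the coefficients into array `3`. -/
def coeffProg : Prog :=
  .forUp 5 (.reg 0) (.seq (.setReg 6 (.lit 1)) (.seq (.setReg 7 (.reg 5)) (.seq factProg (.seq
    (.setReg 7 (.sub (.sub (.reg 0) (.lit 1)) (.reg 5))) (.seq factProg
    (.setArr 3 (.reg 5) (.reg 6)))))))

/-- Cells from `n` on are never written; their initial 0 agrees with the convention in `coeff`, and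
the table does look them up, since its size coordinate runs through all numbers below the base. -/
theorem coeffProg_spec {n : ℕ} {I : Rep n} {i : Fin n} {σ : State} {Y : ℕ}
    (h : I.HasInput i σ) (h3 : ∀ x, σ.arr 3 x = 0) (hY : I.base + 1 ≤ Y) :
    Spec coeffProg (1000000 * Y * Y * Y) σ fun τ => ∀ s : ℕ, τ.arr 3 s = Rep.coeff n s := by
  have hn : n + 1 ≤ Y := by
    unfold Rep.base at hY
    omega
  have hYY : Y ≤ Y * Y := Nat.le_mul_self Y
  refine (Spec.forUp n (c := 30100 * (Y * Y)) (Y := Y)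
    (fun j τ => ∀ s : ℕ, τ.arr 3 s = if s < j then Rep.coeff n s else 0) rfl ?_ ?_ ?_ ?_
    (by nlinarith) (by simp [Expr.cost]) hn).mono (by nlinarith) ?_
  · intro j τ z hj
    simpa using hj
  · intro τ ha
    exact (h.of_agree ha).num
  · simp [h3]
  · intro j hj τ ha hr hI
    have hin := h.of_agree ha
    refine Spec.seq_setReg (d := 30080 * (Y * Y)) ?_ (by simp only [Expr.cost]; nlinarith)
    refine Spec.seq_setReg (d := 30060 * (Y * Y)) ?_ (by simp only [Expr.cost]; nlinarith)
    refine Spec.seq_of (d := 15050 * (Y * Y)) (factProg_spec (N := j) (Y := Y)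
      (by simp [Expr.eval, hr]) (by omega)) ?_ (by nlinarith)
    intro υ aυ hυ
    have e0 : υ.reg 0 = n := by
      rw [aυ.reg 0 rfl]
      simpa using hin.num
    have e5 : υ.reg 5 = j := by
      rw [aυ.reg 5 rfl]
      simpa using hr
    refine Spec.seq_setReg (d := 15030 * (Y * Y)) ?_ (by simp only [Expr.cost]; nlinarith)
    refine Spec.seq_of (d := 3) (factProg_spec (N := n - 1 - j) (Y := Y)
      (by simp only [Expr.eval, e0, e5, State.setReg_reg, if_true]; omega) (by omega)) ?_
      (by nlinarith)
    intro ω aω hω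
    refine Spec.setArr ?_
    intro s
    have f5 : ω.reg 5 = j := by
      rw [aω.reg 5 rfl]
      simpa using e5
    simp only [Expr.eval, State.setArr_arr, f5, true_and, Nat.cast_inj]
    by_cases hs : s = j
    · subst hs
      rw [if_pos rfl, if_pos (by omega), Rep.coeff, if_pos hj, hω]
      simp [hυ, Expr.eval]
    · rw [if_neg hs, aω.arr 3 rfl, State.setReg_arr, aυ.arr 3 rfl, State.setReg_arr,
        State.setReg_arr, hI s]
      refine if_congr ?_ rfl rfl
      omega
  · intro τ _ hτ s
    rw [hτ]
    split_ifs with hs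
    · rfl
    · rw [Rep.coeff, if_neg hs]

/-! ### The table -/

/-- The position of a table entry in memory. -/
def addr (B p s b x m : ℕ) : ℕ := (((p * B + s) * B + b) * B + x) * B + m

/-- The expression for the position of a table entry. -/
def addrExpr (p s b x m : Expr) : Expr :=
  .add (.add (.add (.add (.get 14 p) (.get 13 s)) (.get 12 b)) (.get 11 x)) m

/-- The first four coordinates are looked up in the multiplication tables and must be in their
range; the last is simply added. -/
theorem addrExpr_eval {B : ℕ} {σ : State} (h : HasTables B σ) {p s b x m : Expr}
    {p' s' b' x' m' : ℕ} (hp : p.eval σ = p') (hs : s.eval σ = s') (hb : b.eval σ = b')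
    (hx : x.eval σ = x') (hm : m.eval σ = m') (kp : p' < B) (ks : s' < B) (kb : b' < B)
    (kx : x' < B) : (addrExpr p s b x m).eval σ = addr B p' s' b' x' m' := by
  simp only [addrExpr, Expr.eval, hp, hs, hb, hx, hm, h.one _ kx, h.two _ kb, h.three _ ks,
    h.four _ kp, addr]
  push_cast
  ring

theorem mul_add_lt {B q q' r r' : ℕ} (h : q < q') (hr : r < B) : q * B + r < q' * B + r' := by
  have : (q + 1) * B ≤ q' * B := Nat.mul_le_mul_right B h
  have : (q + 1) * B = q * B + B := by ring
  omega

theorem mul_add_inj {B q q' r r' : ℕ} (hr : r < B) (hr' : r' < B)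
    (h : q * B + r = q' * B + r') : q = q' ∧ r = r' := by
  rcases lt_trichotomy q q' with hq | rfl | hq
  · exact absurd h (mul_add_lt hq hr).ne
  · exact ⟨rfl, by omega⟩
  · exact absurd h.symm (mul_add_lt hq hr').ne

/-- Addresses are ordered lexicographically, so a whole layer precedes the next one and is complete
when the recursion refers to it. -/
theorem addr_lt {B p p' s s' b b' x x' m m' : ℕ} (h : p < p') (hs : s < B) (hb : b < B)
    (hx : x < B) (hm : m < B) : addr B p s b x m < addr B p' s' b' x' m' :=
  mul_add_lt (mul_add_lt (mul_add_lt (mul_add_lt h hs) hb) hx) hm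

/-- Uniqueness of digits in base `B`; the leading digit `p` needs no bound. -/
theorem addr_inj {B p p' s s' b b' x x' m m' : ℕ} (hs : s < B) (hb : b < B) (hx : x < B)
    (hm : m < B) (hs' : s' < B) (hb' : b' < B) (hx' : x' < B) (hm' : m' < B)
    (h : addr B p s b x m = addr B p' s' b' x' m') :
    p = p' ∧ s = s' ∧ b = b' ∧ x = x' ∧ m = m' := by
  obtain ⟨h₁, rfl⟩ := mul_add_inj hm hm' h
  obtain ⟨h₂, rfl⟩ := mul_add_inj hx hx' h₁
  obtain ⟨h₃, rfl⟩ := mul_add_inj hb hb' h₂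
  obtain ⟨rfl, rfl⟩ := mul_add_inj hs hs' h₃
  exact ⟨rfl, rfl, rfl, rfl, rfl⟩

/-! ### The table entries reached by the recursion, and the partially filled table -/

namespace Rep

variable {n : ℕ} (I : Rep n) (i : Fin n)

/-- The table entries that are needed. -/
structure Needed (p s b x m : ℕ) : Prop where
  size : s + p ≤ n
  cap : b ≤ I.bin
  weight : x + ((I.lastAgents i p).map I.weight).sum ≤ I.total
  top : m ≤ I.total

theorem weight_le_total (k : Fin n) : I.weight k ≤ I.total :=
  Finset.single_le_sum (f := I.weight) (fun _ _ => Nat.zero_le _) (Finset.mem_univ k)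

theorem needed_start : I.Needed i n 0 I.bin 0 0 where
  size := by omega
  cap := le_rfl
  weight := by
    rw [zero_add, ← List.sum_toFinset _
      ((I.pairwise_lastAgents i le_rfl).imp fun h => ((I.before_iff _ _).1 h).2),
      I.toFinset_lastAgents, total]
  top := by omega

variable {I i}

theorem Needed.lt_base {p s b x m : ℕ} (h : I.Needed i p s b x m) :
    s < I.base ∧ b < I.base ∧ x < I.base ∧ m < I.base := by
  have := h.size
  have := h.cap
  have := h.weight
  have := h.top
  unfold base
  omega

theorem Needed.skip {p s b x m : ℕ} (h : I.Needed i (p + 1) s b x m) : I.Needed i p s b x m where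
  size := by have := h.size; omega
  cap := h.cap
  weight := by
    have := h.weight
    simp only [lastAgents, List.map_cons, List.sum_cons] at this
    omega
  top := h.top

/-- The weight that `x` may gain is the weight of the agent that leaves the remaining list, so their
sum stays bounded. Allowing any `s' ≤ s + 1` covers both the case of agent `i` and that of the
others. -/
theorem Needed.take {p s b x m : ℕ} (h : I.Needed i (p + 1) s b x m) {s' : ℕ} (hs : s' ≤ s + 1) :
    I.Needed i p s' (I.nextCap (I.ord i p) b) (I.nextWeight (I.ord i p) b x)
      (max m (I.weight (I.ord i p))) where
  size := by have := h.size; omega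
  cap := by
    have := h.cap
    unfold nextCap
    split_ifs <;> omega
  weight := by
    have := h.weight
    simp only [lastAgents, List.map_cons, List.sum_cons] at this
    unfold nextWeight
    split_ifs <;> omega
  top := max_le h.top (I.weight_le_total _)

variable (I i)

/-- Everything that is computed before the table. -/
structure Ready (σ : State) : Prop where
  input : I.HasInput i σ
  tables : HasTables I.base σ
  ord : ∀ p < n, σ.arr 2 p = (I.ord i p).val
  coeff : ∀ s : ℕ, σ.arr 3 s = Rep.coeff n s

/-- The needed table entries at positions below `A` are in place. -/
def Filled (A : ℕ) (σ : State) : Prop :=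
  ∀ p s b x m, p ≤ n → I.Needed i p s b x m → addr I.base p s b x m < A →
    σ.arr 4 (addr I.base p s b x m) = I.table i p s b x m

variable {I i}

theorem Ready.of_agree {p : Prog} {σ τ : State} (h : I.Ready i σ) (ha : Agree p σ τ)
    (h0 : p.modReg 0 = false := by rfl) (h1 : p.modReg 1 = false := by rfl)
    (h2 : p.modReg 2 = false := by rfl) (h4 : p.modReg 4 = false := by rfl)
    (k0 : p.modArr 0 = false := by rfl) (k1 : p.modArr 1 = false := by rfl)
    (k2 : p.modArr 2 = false := by rfl) (k3 : p.modArr 3 = false := by rfl)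
    (k11 : p.modArr 11 = false := by rfl) (k12 : p.modArr 12 = false := by rfl)
    (k13 : p.modArr 13 = false := by rfl) (k14 : p.modArr 14 = false := by rfl) :
    I.Ready i τ where
  input := h.input.of_agree ha h0 h1 h2 k0 k1
  tables := h.tables.of_agree ha h4 k11 k12 k13 k14
  ord := by rw [ha.arr 2 k2]; exact h.ord
  coeff := by rw [ha.arr 3 k3]; exact h.coeff

theorem Filled.congr {A : ℕ} {σ τ : State} (h : I.Filled i A σ) (ha : τ.arr 4 = σ.arr 4) :
    I.Filled i A τ := by
  unfold Filled
  rw [ha]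
  exact h

/-- Writing one entry. -/
theorem Filled.write {σ : State} {p s b x m : ℕ} (hs : s < I.base)
    (hb : b < I.base) (hx : x < I.base) (hm : m < I.base)
    (h : I.Filled i (addr I.base p s b x m) σ) {z : ℤ}
    (hz : I.Needed i p s b x m → z = I.table i p s b x m) :
    I.Filled i (addr I.base p s b x m + 1) (σ.setArr 4 (addr I.base p s b x m : ℕ) z) := by
  intro p' s' b' x' m' hp' hN hlt
  simp only [State.setArr_arr, true_and, Nat.cast_inj]
  obtain ⟨ks, kb, kx, km⟩ := hN.lt_base
  split_ifs with heq
  · obtain ⟨rfl, rfl, rfl, rfl, rfl⟩ := addr_inj ks kb kx km hs hb hx hm heq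
    exact hz hN
  · exact h p' s' b' x' m' hp' hN (by omega)

end Rep

/-! ### Computing a single table entry -/

/-- The position of the current table entry. -/
def currentExpr : Expr := addrExpr (.reg 20) (.reg 21) (.reg 22) (.reg 23) (.reg 24)

/-- The table entry for the current selection without the current agent. -/
def skipExpr : Expr :=
  .get 4 (addrExpr (.sub (.reg 20) (.lit 1)) (.reg 21) (.reg 22) (.reg 23) (.reg 24))

/-- The table entry for the current selection with the current agent. -/
def takeExpr (s : Expr) : Expr :=
  .get 4 (addrExpr (.sub (.reg 20) (.lit 1)) s (.reg 34) (.reg 35) (.reg 36))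

/-- Compute an entry of the first layer. -/
def firstProg : Prog :=
  .seq (.ite (.sub (.reg 23) (.reg 24)) (.setReg 30 (.reg 23)) (.setReg 30 (.reg 24)))
    (.seq (.setReg 31 (.lit 0)) (.seq (.accumulate 32 31 (.reg 30) (.get 3 (.reg 21)))
    (.setArr 4 currentExpr (.reg 31))))

/-- Add the current agent to the current selection. -/
def takeProg : Prog :=
  .seq (.setReg 33 (.get 2 (.sub (.reg 20) (.lit 1)))) (.seq
    (.ite (.add (.sub (.reg 22) (.get 0 (.reg 33))) (.lit 1))
      (.seq (.setReg 34 (.sub (.reg 22) (.get 0 (.reg 33))))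
        (.setReg 35 (.add (.reg 23) (.get 1 (.reg 33)))))
      (.seq (.setReg 34 (.lit 0)) (.setReg 35 (.reg 23))))
    (.ite (.sub (.reg 24) (.get 1 (.reg 33))) (.setReg 36 (.reg 24))
      (.setReg 36 (.get 1 (.reg 33)))))

/-- Combine two table entries of the previous layer. -/
def combineProg : Prog :=
  .ite (.sub (.reg 33) (.reg 2))
    (.setArr 4 currentExpr (.add (takeExpr (.add (.reg 21) (.lit 1))) skipExpr))
    (.ite (.sub (.reg 2) (.reg 33))
      (.setArr 4 currentExpr (.add (takeExpr (.add (.reg 21) (.lit 1))) skipExpr))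
      (.setArr 4 currentExpr (.sub (takeExpr (.reg 21)) skipExpr)))

/-- Compute the current table entry. -/
def entryProg : Prog := .ite (.reg 20) (.seq takeProg combineProg) firstProg

/-- The current table entry is the one with the given coordinates. -/
structure Current (p s b x m : ℕ) (σ : State) : Prop where
  layer : σ.reg 20 = p
  size : σ.reg 21 = s
  cap : σ.reg 22 = b
  weight : σ.reg 23 = x
  top : σ.reg 24 = m

theorem Current.of_agree {p s b x m : ℕ} {q : Prog} {σ τ : State} (h : Current p s b x m σ)
    (ha : Agree q σ τ) (h0 : q.modReg 20 = false := by rfl) (h1 : q.modReg 21 = false := by rfl)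
    (h2 : q.modReg 22 = false := by rfl) (h3 : q.modReg 23 = false := by rfl)
    (h4 : q.modReg 24 = false := by rfl) : Current p s b x m τ where
  layer := (ha.reg 20 h0).trans h.layer
  size := (ha.reg 21 h1).trans h.size
  cap := (ha.reg 22 h2).trans h.cap
  weight := (ha.reg 23 h3).trans h.weight
  top := (ha.reg 24 h4).trans h.top

section Entry

variable {n : ℕ} {I : Rep n} {i : Fin n} {σ : State} {Y p s b x m : ℕ}

theorem currentExpr_eval (h : I.Ready i σ) (hc : Current p s b x m σ) (hp : p ≤ n)
    (hs : s < I.base) (hb : b < I.base) (hx : x < I.base) :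
    currentExpr.eval σ = addr I.base p s b x m :=
  addrExpr_eval h.tables hc.layer hc.size hc.cap hc.weight hc.top
    (by unfold Rep.base; omega) hs hb hx

/-- The only entries that need more than constant time: the coefficient is added `max x m` times, a
number below the base. -/
theorem firstProg_spec (h : I.Ready i σ) (hc : Current 0 s b x m σ) (hs : s < I.base)
    (hb : b < I.base) (hx : x < I.base) (hm : m < I.base)
    (hF : I.Filled i (addr I.base 0 s b x m) σ) (hY : I.base + 1 ≤ Y) :
    Spec firstProg (500 * Y) σ (I.Filled i (addr I.base 0 s b x m + 1)) := by
  refine Spec.seq_of (c := 10) (d := 490 * Y)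
    (R := fun τ => τ.reg 30 = (max x m : ℕ)) ?_ ?_ (by omega)
  · refine (Spec.ite (c := 2) (d := 2) ?_ ?_).le (by simp [Expr.cost])
    · intro hlt
      simp only [Expr.eval, hc.weight, hc.top] at hlt
      refine Spec.setReg ?_
      simp only [Expr.eval, State.setReg_reg, if_true, hc.weight, Nat.cast_inj]
      omega
    · intro hlt
      simp only [Expr.eval, hc.weight, hc.top] at hlt
      refine Spec.setReg ?_
      simp only [Expr.eval, State.setReg_reg, if_true, hc.top, Nat.cast_inj]
      omega
  intro τ aτ hτ
  have hτR := h.of_agree aτ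
  have hτc := hc.of_agree aτ
  refine Spec.seq_setReg (d := 450 * Y) ?_ (by simp only [Expr.cost]; omega)
  have hmax : max x m + 1 ≤ Y := by omega
  refine Spec.seq_of (d := 20) (Spec.accumulate (Y := Y) (max x m) (Rep.coeff n s) (by norm_num)
    ?_ ?_ (by simp [Expr.cost]) (by simp [Expr.cost]) hmax) ?_ (by omega)
  · intro υ aυ
    simpa [Expr.eval, hτ] using aυ.reg 30 rfl
  · intro υ aυ
    simp [Expr.eval, aυ.arr 3 rfl, aυ.reg 21 rfl, hτc.size, hτR.coeff]
  intro υ aυ hυ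
  have ag := (Run.setReg τ 31 (.lit 0)).agree
  have hυR : I.Ready i υ := Rep.Ready.of_agree (hτR.of_agree ag) aυ
  have hυc : Current 0 s b x m υ := Current.of_agree (hτc.of_agree ag) aυ
  refine (Spec.setArr ?_).le (by simp [Expr.cost, currentExpr, addrExpr])
  rw [currentExpr_eval hυR hυc (Nat.zero_le n) hs hb hx]
  refine Rep.Filled.write hs hb hx hm (hF.congr ?_) ?_
  · rw [aυ.arr 4 rfl, State.setReg_arr, aτ.arr 4 rfl]
  · intro _
    simp only [Expr.eval, hυ, Rep.table, State.setReg_reg, if_true]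
    push_cast
    ring

theorem takeProg_spec (h : I.Ready i σ) (hc : Current (p + 1) s b x m σ) (hp : p < n) :
    Spec takeProg 100 σ fun τ => τ.reg 33 = (I.ord i p).val ∧
      τ.reg 34 = I.nextCap (I.ord i p) b ∧ τ.reg 35 = I.nextWeight (I.ord i p) b x ∧
      τ.reg 36 = (max m (I.weight (I.ord i p)) : ℕ) := by
  refine Spec.seq_setReg (d := 80) ?_ (by simp [Expr.cost])
  set τ := σ.setReg 33 _ with hτ
  have h33 : τ.reg 33 = (I.ord i p).val := by
    simp [hτ, Expr.eval, hc.layer, h.ord p hp]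
  have aτ : Agree (.setReg 33 (.get 2 (.sub (.reg 20) (.lit 1)))) σ τ := (Run.setReg _ _ _).agree
  replace hc := hc.of_agree aτ
  replace h := (h.of_agree aτ).input
  clear_value τ
  refine Spec.seq_of (c := 40) (d := 20) (R := fun υ =>
    υ.reg 34 = I.nextCap (I.ord i p) b ∧ υ.reg 35 = I.nextWeight (I.ord i p) b x) ?_ ?_ (by omega)
  · refine (Spec.ite (c := 15) (d := 10) ?_ ?_).le (by simp [Expr.cost])
    · intro hlt
      simp only [Expr.eval, hc.cap, h33, h.len] at hlt
      -- The machine tests positivity only, so `len ≤ cap` is tested as `0 < cap - len + 1`.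
      have hle : I.len (I.ord i p) ≤ b := by omega
      refine Spec.seq_setReg (d := 8) ((Spec.setReg ?_).le (by simp [Expr.cost]))
        (by simp [Expr.cost])
      simp [Expr.eval, hc.cap, hc.weight, h33, h.len, h.weight, Rep.nextCap, Rep.nextWeight, hle]
    · intro hlt
      simp only [Expr.eval, hc.cap, h33, h.len] at hlt
      have hle : ¬ I.len (I.ord i p) ≤ b := by omega
      refine Spec.seq_setReg (d := 2) ((Spec.setReg ?_).le (by simp [Expr.cost]))
        (by simp [Expr.cost])
      simp [Expr.eval, hc.weight, Rep.nextCap, Rep.nextWeight, hle]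
  rintro υ aυ ⟨h34, h35⟩
  have k33 : υ.reg 33 = (I.ord i p).val := (aυ.reg 33 rfl).trans h33
  replace hc := hc.of_agree aυ
  replace h := h.of_agree aυ
  refine (Spec.ite (c := 4) (d := 4) ?_ ?_).le (by simp [Expr.cost])
  · intro hlt
    simp only [Expr.eval, hc.top, k33, h.weight] at hlt
    refine (Spec.setReg ⟨?_, ?_, ?_, ?_⟩).le (by simp [Expr.cost])
    · simpa using k33
    · simpa using h34
    · simpa using h35
    · simp only [Expr.eval, State.setReg_reg, if_true, hc.top, Nat.cast_inj]
      omega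
  · intro hlt
    simp only [Expr.eval, hc.top, k33, h.weight] at hlt
    refine (Spec.setReg ⟨?_, ?_, ?_, ?_⟩).le (by simp [Expr.cost])
    · simpa using k33
    · simpa using h34
    · simpa using h35
    · simp only [Expr.eval, State.setReg_reg, if_true, k33, h.weight, Nat.cast_inj]
      omega

theorem skipExpr_eval (h : I.Ready i σ) (hc : Current (p + 1) s b x m σ) (hp : p < n)
    (hF : I.Filled i (addr I.base (p + 1) s b x m) σ) (hN : I.Needed i (p + 1) s b x m) :
    skipExpr.eval σ = I.table i p s b x m := by
  obtain ⟨ks, kb, kx, km⟩ := hN.skip.lt_base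
  rw [skipExpr, Expr.eval, addrExpr_eval (p' := p) (s := .reg 21) (b := .reg 22) (x := .reg 23)
    (m := .reg 24) h.tables (by simp [Expr.eval, hc.layer]) hc.size
    hc.cap hc.weight hc.top (by unfold Rep.base; omega) ks kb kx]
  exact hF _ _ _ _ _ hp.le hN.skip (addr_lt (Nat.lt_succ_self p) ks kb kx km)

theorem takeExpr_eval (h : I.Ready i σ) (hc : Current (p + 1) s b x m σ) (hp : p < n)
    (hF : I.Filled i (addr I.base (p + 1) s b x m) σ) (hN : I.Needed i (p + 1) s b x m)
    (h34 : σ.reg 34 = I.nextCap (I.ord i p) b) (h35 : σ.reg 35 = I.nextWeight (I.ord i p) b x)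
    (h36 : σ.reg 36 = (max m (I.weight (I.ord i p)) : ℕ)) {e : Expr} {s' : ℕ}
    (he : e.eval σ = s') (hs : s' ≤ s + 1) :
    (takeExpr e).eval σ = I.table i p s' (I.nextCap (I.ord i p) b)
      (I.nextWeight (I.ord i p) b x) (max m (I.weight (I.ord i p))) := by
  have hN' := hN.take hs
  obtain ⟨ks, kb, kx, km⟩ := hN'.lt_base
  rw [takeExpr, Expr.eval, addrExpr_eval (p' := p) (b := .reg 34) (x := .reg 35) (m := .reg 36)
    h.tables (by simp [Expr.eval, hc.layer]) he
    h34 h35 h36 (by unfold Rep.base; omega) ks kb kx]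
  exact hF _ _ _ _ _ hp.le hN' (addr_lt (Nat.lt_succ_self p) ks kb kx km)

/-- The entry need not satisfy `Needed`: the loops visit all coordinates below the base, and at the
other positions any number may be written, because `Filled` says nothing about them. -/
theorem entryProg_spec (h : I.Ready i σ) (hc : Current p s b x m σ) (hp : p ≤ n)
    (hs : s < I.base) (hb : b < I.base) (hx : x < I.base) (hm : m < I.base)
    (hF : I.Filled i (addr I.base p s b x m) σ) (hY : I.base + 1 ≤ Y) :
    Spec entryProg (1000 * Y) σ (I.Filled i (addr I.base p s b x m + 1)) := by
  refine (Spec.ite (c := 500 * Y) (d := 500 * Y) ?_ ?_).le (by simp only [Expr.cost]; omega)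
  · intro hpos
    simp only [Expr.eval, hc.layer] at hpos
    obtain ⟨p, rfl⟩ : ∃ q, p = q + 1 := ⟨p - 1, by omega⟩
    refine Spec.seq_of (d := 200) (takeProg_spec h hc hp) ?_ (by omega)
    rintro τ aτ ⟨h33, h34, h35, h36⟩
    replace h := h.of_agree aτ
    replace hc := hc.of_agree aτ
    replace hF := hF.congr (aτ.arr 4 rfl)
    have hcur := currentExpr_eval h hc hp hs hb hx
    -- Inequality of agents is detected by two positivity tests, and both positive outcomes run this
    -- same assignment.
    have hother : I.ord i p ≠ i →
        Spec (.setArr 4 currentExpr (.add (takeExpr (.add (.reg 21) (.lit 1))) skipExpr)) 100 τ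
          (I.Filled i (addr I.base (p + 1) s b x m + 1)) := by
      intro hne
      refine (Spec.setArr ?_).le
        (by simp [Expr.cost, currentExpr, addrExpr, takeExpr, skipExpr])
      rw [hcur]
      refine Rep.Filled.write hs hb hx hm hF fun hN => ?_
      rw [Expr.eval, skipExpr_eval h hc hp hF hN, takeExpr_eval h hc hp hF hN h34 h35 h36
        (s' := s + 1) (by simp [Expr.eval, hc.size]) le_rfl, Rep.table, if_neg hne]
    refine (Spec.ite (c := 100) (d := 150) ?_ ?_).le (by simp [Expr.cost])
    · intro hlt
      simp only [Expr.eval, h33, h.input.agent] at hlt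
      exact hother fun he => by rw [he] at hlt; omega
    intro hle
    simp only [Expr.eval, h33, h.input.agent] at hle
    refine (Spec.ite (c := 100) (d := 100) ?_ ?_).le (by simp [Expr.cost])
    · intro hlt
      simp only [Expr.eval, h33, h.input.agent] at hlt
      exact hother fun he => by rw [he] at hlt; omega
    intro hge
    simp only [Expr.eval, h33, h.input.agent] at hge
    have he : I.ord i p = i := Fin.ext (by omega)
    refine (Spec.setArr ?_).le (by simp [Expr.cost, currentExpr, addrExpr, takeExpr, skipExpr])
    rw [hcur]
    refine Rep.Filled.write hs hb hx hm hF fun hN => ?_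
    rw [Expr.eval, skipExpr_eval h hc hp hF hN, takeExpr_eval h hc hp hF hN h34 h35 h36
      (e := .reg 21) (s' := s) hc.size (by omega), Rep.table, if_pos he]
  · intro hpos
    simp only [Expr.eval, hc.layer] at hpos
    obtain rfl : p = 0 := by omega
    exact firstProg_spec h hc hs hb hx hm hF hY

end Entry

/-- Fill the table. -/
def tableProg : Prog :=
  .forUp 20 (.add (.reg 0) (.lit 1)) (.forUp 21 (.reg 4) (.forUp 22 (.reg 4)
    (.forUp 23 (.reg 4) (.forUp 24 (.reg 4) entryProg))))

/-- The nested loops visit the positions in increasing order, so every invariant says that the table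
is filled up to the current address. The layers are counted by `Z` and not by `Y`: a sixth factor
`Y` would bring in a sixth power of the bin size. -/
theorem tableProg_spec {n : ℕ} {I : Rep n} {i : Fin n} {σ : State} {Y Z : ℕ} (h : I.Ready i σ)
    (hY : I.base + 1 ≤ Y) (hZ : n + 2 ≤ Z) :
    Spec tableProg (30 * (30 * (30 * (30 * (30 * (1000 * Y) * Y) * Y) * Y) * Y) * Z) σ fun τ =>
      I.Filled i (addr I.base (n + 1) 0 0 0 0) τ := by
  have hY1 : 0 < Y := by omega
  have hlim : ∀ {τ υ : State} {p : Prog}, I.Ready i τ → Agree p τ υ → p.modReg 4 = false →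
      (Expr.reg 4).eval υ = (I.base : ℕ) := fun hτ ha h4 =>
    (ha.reg 4 h4).trans hτ.tables.base
  refine (Spec.forUp (n + 1) (Y := Z) (fun j τ => I.Filled i (addr I.base j 0 0 0 0) τ) rfl
    (fun j τ z hj => hj) ?_ ?_ ?_ (Nat.succ_le_of_lt (by positivity)) (by simp [Expr.cost]) (by omega))
  · intro τ ha
    simp [Expr.eval, (h.of_agree ha).input.num]
  · intro p s b x m _ _ hlt
    simp [addr] at hlt
  intro p hp τ₀ a₀ r₀ F₀
  have R₀ : I.Ready i τ₀ := h.of_agree a₀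
  refine (Spec.forUp I.base (Y := Y) (fun j τ => I.Filled i (addr I.base p j 0 0 0) τ) rfl
    (fun j τ z hj => hj) (fun υ ha => hlim R₀ ha rfl) F₀ ?_ (Nat.succ_le_of_lt (by positivity)) (by simp [Expr.cost])
    hY).mono le_rfl ?_
  swap
  · intro υ _ hυ
    -- A carry: the digit `B` in one place is the same address as one more in the place before it,
    -- with 0 here.
    convert hυ using 1
    simp only [addr]
    ring
  intro s hs τ₁ a₁ r₁ F₁
  have R₁ : I.Ready i τ₁ := R₀.of_agree a₁
  refine (Spec.forUp I.base (Y := Y) (fun j τ => I.Filled i (addr I.base p s j 0 0) τ) rfl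
    (fun j τ z hj => hj) (fun υ ha => hlim R₁ ha rfl) F₁ ?_ (Nat.succ_le_of_lt (by positivity)) (by simp [Expr.cost])
    hY).mono le_rfl ?_
  swap
  · intro υ _ hυ
    convert hυ using 1
    simp only [addr]
    ring
  intro b hb τ₂ a₂ r₂ F₂
  have R₂ : I.Ready i τ₂ := R₁.of_agree a₂
  refine (Spec.forUp I.base (Y := Y) (fun j τ => I.Filled i (addr I.base p s b j 0) τ) rfl
    (fun j τ z hj => hj) (fun υ ha => hlim R₂ ha rfl) F₂ ?_ (Nat.succ_le_of_lt (by positivity)) (by simp [Expr.cost])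
    hY).mono le_rfl ?_
  swap
  · intro υ _ hυ
    convert hυ using 1
    simp only [addr]
    ring
  intro x hx τ₃ a₃ r₃ F₃
  have R₃ : I.Ready i τ₃ := R₂.of_agree a₃
  refine (Spec.forUp I.base (Y := Y) (fun j τ => I.Filled i (addr I.base p s b x j) τ) rfl
    (fun j τ z hj => hj) (fun υ ha => hlim R₃ ha rfl) F₃ ?_ (Nat.succ_le_of_lt (by positivity)) (by simp [Expr.cost])
    hY).mono le_rfl ?_
  swap
  · intro υ _ hυ
    convert hυ using 1
    simp only [addr]
    ring
  intro m hm τ₄ a₄ r₄ F₄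
  have R₄ : I.Ready i τ₄ := R₃.of_agree a₄
  refine entryProg_spec R₄ ⟨?_, ?_, ?_, ?_, r₄⟩ (by omega) hs hb hx hm F₄ hY
  · rw [a₄.reg 20 rfl, a₃.reg 20 rfl, a₂.reg 20 rfl, a₁.reg 20 rfl, r₀]
  · rw [a₄.reg 21 rfl, a₃.reg 21 rfl, a₂.reg 21 rfl, r₁]
  · rw [a₄.reg 22 rfl, a₃.reg 22 rfl, r₂]
  · rw [a₄.reg 23 rfl, r₃]

/-! ### The whole program -/

/-- Compute the Shapley value of an agent. -/
def shapleyProg : Prog :=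
  .seq setupProg (.seq ordProg (.seq coeffProg (.seq tableProg (.seq
    (.setReg 6 (.lit 1)) (.seq (.setReg 7 (.reg 0)) (.seq factProg (.seq
    (.setReg 0 (.get 4 (addrExpr (.reg 0) (.lit 0) (.reg 1) (.lit 0) (.lit 0))))
    (.setReg 1 (.reg 6)))))))))

theorem shapleyProg_spec {n : ℕ} (I : Rep n) (i : Fin n) {Y Z : ℕ}
    (hY : I.base + 1 ≤ Y) (hZ : n + 2 ≤ Z) :
    Spec shapleyProg (10 ^ 12 * (Z * Y ^ 5)) (input I i) fun τ =>
      τ.Outputs (shapley I.value i) := by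
  have hY1 : 1 ≤ Y := by omega
  have hZ1 : 1 ≤ Z := by omega
  have p1 : Y ≤ Z * Y ^ 5 := by
    calc Y = 1 * Y ^ 1 := by ring
      _ ≤ Z * Y ^ 5 := Nat.mul_le_mul hZ1 (Nat.pow_le_pow_right hY1 (by norm_num))
  have p2 : Y * Y ≤ Z * Y ^ 5 := by
    calc Y * Y = 1 * Y ^ 2 := by ring
      _ ≤ Z * Y ^ 5 := Nat.mul_le_mul hZ1 (Nat.pow_le_pow_right hY1 (by norm_num))
  have p3 : Y * Y * Y ≤ Z * Y ^ 5 := by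
    calc Y * Y * Y = 1 * Y ^ 3 := by ring
      _ ≤ Z * Y ^ 5 := Nat.mul_le_mul hZ1 (Nat.pow_le_pow_right hY1 (by norm_num))
  have p5 : 30 * (30 * (30 * (30 * (30 * (1000 * Y) * Y) * Y) * Y) * Y) * Z =
      24300000000 * (Z * Y ^ 5) := by ring
  have q1 : 1000000 * Y * Y * Y = 1000000 * (Y * Y * Y) := by ring
  -- With every cost bounded by a multiple of the single quantity `X`, the remaining estimates are
  -- linear.
  generalize hX : Z * Y ^ 5 = X at *
  have hin := I.hasInput_input i
  refine Spec.seq_of (d := 10 ^ 11 * X) (setupProg_spec hin rfl hY) ?_ (by omega)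
  intro τ₁ a₁ t₁
  have i₁ := hin.of_agree a₁
  refine Spec.seq_of (d := 10 ^ 11 * X - 1000000 * X) (ordProg_spec i₁ hY) ?_ (by omega)
  intro τ₂ a₂ o₂
  have i₂ := i₁.of_agree a₂
  have t₂ := t₁.of_agree a₂
  refine Spec.seq_of (d := 9 * 10 ^ 10 * X) (coeffProg_spec i₂ ?_ hY) ?_ (by omega)
  · intro x
    rw [a₂.arr 3 rfl, a₁.arr 3 rfl]
    simp [input]
  intro τ₃ a₃ c₃
  have R₃ : I.Ready i τ₃ := ⟨i₂.of_agree a₃, t₂.of_agree a₃, by rw [a₃.arr 2 rfl]; exact o₂, c₃⟩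
  refine Spec.seq_of (d := 20000 * X) (tableProg_spec R₃ hY hZ) ?_ (by omega)
  intro τ₄ a₄ F₄
  have R₄ := R₃.of_agree a₄
  refine Spec.seq_setReg (d := 19000 * X) ?_ (by simp only [Expr.cost]; omega)
  refine Spec.seq_setReg (d := 18000 * X) ?_ (by simp only [Expr.cost]; omega)
  have hn : n + 1 ≤ Y := by
    unfold Rep.base at hY
    omega
  refine Spec.seq_of (d := 50) (factProg_spec (N := n) (Y := Y)
    (by simp [Expr.eval, R₄.input.num]) hn) ?_ (by omega)
  intro τ₅ a₅ f₅
  have ag := (Run.seq (Run.setReg τ₄ 6 (.lit 1)) (Run.setReg _ 7 (.reg 0))).agree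
  have R₅ : I.Ready i τ₅ := Rep.Ready.of_agree (R₄.of_agree ag) a₅
  have e6 : τ₅.reg 6 = n.factorial := by simpa [Expr.eval] using f₅
  have hN := I.needed_start i
  obtain ⟨ks, kb, kx, km⟩ := hN.lt_base
  have hval : (Expr.get 4 (addrExpr (.reg 0) (.lit 0) (.reg 1) (.lit 0) (.lit 0))).eval τ₅ =
      I.table i n 0 I.bin 0 0 := by
    rw [Expr.eval, addrExpr_eval (p := .reg 0) (s := .lit 0) (b := .reg 1) (x := .lit 0)
      (m := .lit 0) (p' := n) (s' := 0) (x' := 0) (m' := 0) R₅.tables R₅.input.num rfl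
      R₅.input.bin rfl rfl (by unfold Rep.base; omega) ks kb kx, a₅.arr 4 rfl]
    exact F₄ _ _ _ _ _ le_rfl hN (addr_lt (Nat.lt_succ_self n) ks kb kx km)
  refine Spec.seq_setReg (d := 2) (Spec.setReg ?_) (by simp [Expr.cost, addrExpr])
  rw [hval, I.shapley_eq_table]
  refine ⟨?_, ?_⟩
  · simp [Expr.eval, e6, Nat.factorial_pos]
  · simp [Expr.eval, e6]

/-! ### The running time -/

/-- Since `l_k ≤ l_bin`, one has `w_k = l_k * (w_k / l_k) ≤ l_bin * max_j (w_j / l_j)`. -/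
theorem Rep.weight_le_wmax {n : ℕ} (I : Rep n) (k : Fin n) : I.weight k ≤ I.wmax := by
  have hk : (I.weight k : ℚ≥0) ≤ (I.bin : ℚ≥0) *
      Finset.univ.sup (fun k => (I.weight k : ℚ≥0) / (I.len k : ℚ≥0)) := by
    have hpos : (0 : ℚ≥0) < I.len k := by exact_mod_cast I.len_pos k
    calc (I.weight k : ℚ≥0) = I.len k * (I.weight k / I.len k) := by field_simp
      _ ≤ _ := mul_le_mul' (by exact_mod_cast I.len_le_bin k)
        (Finset.le_sup (f := fun k => (I.weight k : ℚ≥0) / (I.len k : ℚ≥0)) (Finset.mem_univ k))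
  unfold wmax
  exact_mod_cast hk.trans (Nat.le_ceil _)

/-- Each of `n`, `l_bin` and the total weight is at most the product, and the constant 3 is at most
three times the product, hence the factor 6. The agent `i` guarantees that `n` and `l_bin` are
positive. -/
theorem Rep.base_succ_le {n : ℕ} (I : Rep n) (i : Fin n) :
    I.base + 1 ≤ 6 * (n * I.bin * max 1 I.wmax) := by
  have hn : 1 ≤ n := i.pos
  have hb : 1 ≤ I.bin := (I.len_pos i).trans_le (I.len_le_bin i)
  set W := max 1 I.wmax with hW
  have hW1 : 1 ≤ W := le_max_left _ _
  have ht : I.total ≤ n * W := by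
    calc I.total ≤ ∑ _k : Fin n, W :=
          Finset.sum_le_sum fun k _ => (I.weight_le_wmax k).trans (le_max_right _ _)
      _ = n * W := by simp
  have hnb : 1 ≤ n * I.bin := Nat.mul_pos hn hb
  have h1 : n ≤ n * I.bin * W := by
    rw [mul_assoc]
    exact Nat.le_mul_of_pos_right _ (Nat.mul_pos hb hW1)
  have h2 : I.bin ≤ n * I.bin * W :=
    (Nat.le_mul_of_pos_left _ hn).trans (Nat.le_mul_of_pos_right _ hW1)
  have h3 : n * W ≤ n * I.bin * W := Nat.mul_le_mul_right _ (Nat.le_mul_of_pos_right _ hb)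
  unfold base
  omega

end GreedyKnapsack

theorem theorem4 :
    ∃ (P : GreedyKnapsack.Prog) (C : ℕ),
      ∀ (n : ℕ) (I : GreedyKnapsack.Rep n) (i : Fin n),
        ∃ (t : ℕ) (τ : GreedyKnapsack.State),
          GreedyKnapsack.Run P (GreedyKnapsack.input I i) t τ ∧
          τ.Outputs (GreedyKnapsack.shapley I.value i) ∧
          t ≤ C * (I.bin ^ 5 * max 1 I.wmax ^ 5 * n ^ 8) := by
  refine ⟨GreedyKnapsack.shapleyProg, 10 ^ 12 * 3 * 6 ^ 5, fun n I i => ?_⟩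
  have hn : 1 ≤ n := i.pos
  -- `3 * n` bounds `n + 2` because `n ≥ 1`.
  obtain ⟨t, τ, hrun, ht, hout⟩ := GreedyKnapsack.shapleyProg_spec I i (Y := _) (Z := 3 * n)
    (I.base_succ_le i) (by omega)
  refine ⟨t, τ, hrun, hout, ht.trans ?_⟩
  calc 10 ^ 12 * (3 * n * (6 * (n * I.bin * max 1 I.wmax)) ^ 5)
      = 10 ^ 12 * 3 * 6 ^ 5 * (I.bin ^ 5 * max 1 I.wmax ^ 5 * n ^ 6) := by ring
    -- The computation needs only `n ^ 6`; it is relaxed to `n ^ 8`.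
    _ ≤ _ := by gcongr; omega
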